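/- Let $(M,g)$ be a smooth $n$-dimensional Riemannian manifold with Levi-Civita connection $\nabla$, let $\kappa\in\mathbb{R}$, and let $f:M\to\mathbb{R}$ be a smooth function such that $(M,g,f)$ is a gradient Ricci soliton with constant $\kappa$, that is, $\mathrm{Ric}+\mathrm{Hess}_f=\kappa\,g$ (shrinking for $\kappa=\tfrac12$, steady for $\kappa=0$, expanding for $\kappa=-\tfrac12$). For a smooth vector field $Y$, with $(e_i)$ a local orthonormal frame, put $$\mathcal{L}Y=\Delta Y-\nabla_{\nabla f}Y,\qquad \mathrm{div}_f\,Y=\mathrm{div}\,Y-\langle Y,\nabla f\rangle ,$$ where $\Delta Y=\sum_i\nabla^2_{e_i,e_i}Y$ is the rough Laplacian. For a symmetric $2$-tensor $h$ let $\mathrm{div}_f\,h$ be the vector field given by $\langle \mathrm{div}_f\,h,w\rangle=\sum_j(\nabla_{e_j}h)(w,e_j)-h(w,\nabla f)$, let $\mathrm{div}_f^*Y$ be the symmetric $2$-tensor $(\mathrm{div}_f^*Y)(u,w)=-\tfrac12\left(\langle\nabla_uY,w\rangle+\langle\nabla_wY,u\rangle\right)$, and put $\mathcal{P}Y=\mathrm{div}_f(\mathrm{div}_f^*Y)$.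 Then for every smooth vector field $V$ on $M$, $$\mathcal{L}\,\mathcal{P}\,V=\mathcal{P}\,\mathcal{L}\,V\qquad\text{and}\qquad \mathcal{P}\,\nabla\,\mathrm{div}_f(V)=\nabla\,\mathrm{div}_f(\mathcal{P}\,V).$$ -/

import Mathlib

open Bundle Manifold
open scoped ContDiff

noncomputable section

namespace RicciSoliton

variable {n : ℕ} {M : Type*} [TopologicalSpace M] [ChartedSpace (EuclideanSpace ℝ (Fin n)) M]
  [IsManifold (𝓡 n) ∞ M] [RiemannianBundle (fun x : M => TangentSpace (𝓡 n) x)]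

/-- The tangent spaces have the topology of the model space, so they are finite-dimensional. -/
instance finiteDimensional_tangentSpace (x : M) :
    FiniteDimensional ℝ (TangentSpace (𝓡 n) x) :=
  inferInstanceAs (FiniteDimensional ℝ (EuclideanSpace ℝ (Fin n)))

/-- An orthonormal basis of the tangent space at `x`, with respect to the Riemannian metric. All
traces below are taken over it; they do not depend on this choice. -/
def frame (x : M) :
    OrthonormalBasis (Fin (Module.finrank ℝ (TangentSpace (𝓡 n) x))) ℝ (TangentSpace (𝓡 n) x) :=
  stdOrthonormalBasis ℝ (TangentSpace (𝓡 n) x)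

/-- An extension of a tangent vector at `x` to a vector field which is smooth near `x`. -/
def ext {x : M} (v : TangentSpace (𝓡 n) x) : Π y : M, TangentSpace (𝓡 n) y :=
  FiberBundle.extend (EuclideanSpace ℝ (Fin n)) v

/-- The right-hand side of the Koszul formula, `2⟨∇_X Y, Z⟩` at the point `x`. -/
def koszul (X Y Z : Π x : M, TangentSpace (𝓡 n) x) (x : M) : ℝ :=
  mvfderiv (𝓡 n) (fun y => inner ℝ (Y y) (Z y)) x (X x)
    + mvfderiv (𝓡 n) (fun y => inner ℝ (Z y) (X y)) x (Y x)
    - mvfderiv (𝓡 n) (fun y => inner ℝ (X y) (Y y)) x (Z x)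
    + inner ℝ (VectorField.mlieBracket (𝓡 n) X Y x) (Z x)
    - inner ℝ (VectorField.mlieBracket (𝓡 n) X Z x) (Y x)
    - inner ℝ (VectorField.mlieBracket (𝓡 n) Y Z x) (X x)

/-- The Levi-Civita connection of the Riemannian metric: `nabla Y x v` is `∇_v Y` at `x`. -/
def nabla (Y : Π x : M, TangentSpace (𝓡 n) x) (x : M) :
    TangentSpace (𝓡 n) x →L[ℝ] TangentSpace (𝓡 n) x :=
  ∑ i, ∑ j, (koszul (ext (frame x i)) Y (ext (frame x j)) x / 2) •
    (innerSL ℝ (frame x i)).smulRight (frame x j)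

/-- The second covariant derivative of a vector field,
`∇²_{v,w} Y = ∇_v (∇_W Y) - ∇_{∇_v W} Y` where `W` extends `w`. -/
def nabla₂ (Y : Π x : M, TangentSpace (𝓡 n) x) (x : M) (v w : TangentSpace (𝓡 n) x) :
    TangentSpace (𝓡 n) x :=
  nabla (fun y => nabla Y y (ext w y)) x v - nabla Y x (nabla (ext w) x v)

/-- The Riemann curvature `R(u,v)w = ∇_u ∇_v w - ∇_v ∇_u w - ∇_{[u,v]} w`. -/
def curvature (x : M) (u v w : TangentSpace (𝓡 n) x) : TangentSpace (𝓡 n) x :=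
  nabla (fun y => nabla (ext w) y (ext v y)) x u - nabla (fun y => nabla (ext w) y (ext u y)) x v
    - nabla (ext w) x (VectorField.mlieBracket (𝓡 n) (ext u) (ext v) x)

/-- The Ricci curvature: `Ric(v,w)` is the trace of `u ↦ R(u,v)w`. -/
def ricci (x : M) (v w : TangentSpace (𝓡 n) x) : ℝ :=
  ∑ i, inner ℝ (curvature x (frame x i) v w) (frame x i)

/-- The Riemannian gradient of a function. -/
def grad (u : M → ℝ) (x : M) : TangentSpace (𝓡 n) x :=
  ∑ i, mvfderiv (𝓡 n) u x (frame x i) • frame x i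

/-- The Hessian of a function. -/
def hess (u : M → ℝ) (x : M) (v w : TangentSpace (𝓡 n) x) : ℝ :=
  inner ℝ (nabla (grad u) x v) w

/-- `(M, g, f)` is a gradient Ricci soliton with constant `κ`: `Ric + Hess_f = κ g`. -/
structure IsGradientRicciSoliton (f : M → ℝ) (κ : ℝ) : Prop where
  smooth : ContMDiff (𝓡 n) 𝓘(ℝ) ∞ f
  eq : ∀ (x : M) (v w : TangentSpace (𝓡 n) x), ricci x v w + hess f x v w = κ * inner ℝ v w

/-- The drift Laplacian on vector fields, `𝓛 Y = Δ Y - ∇_{∇f} Y`, where `Δ` is the rough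
Laplacian (the trace of the second covariant derivative). -/
def driftLaplacian (f : M → ℝ) (Y : Π x : M, TangentSpace (𝓡 n) x) (x : M) :
    TangentSpace (𝓡 n) x :=
  (∑ i, nabla₂ Y x (frame x i) (frame x i)) - nabla Y x (grad f x)

/-- The weighted divergence of a vector field, `div_f Y = div Y - ⟨Y, ∇f⟩`. -/
def divf (f : M → ℝ) (Y : Π x : M, TangentSpace (𝓡 n) x) (x : M) : ℝ :=
  (∑ i, inner ℝ (nabla Y x (frame x i)) (frame x i)) - inner ℝ (Y x) (grad f x)

/-- The covariant derivative of a 2-tensor,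
`(∇_v h)(u,w) = v(h(U,W)) - h(∇_v U, w) - h(u, ∇_v W)` where `U`, `W` extend `u`, `w`. -/
def nablaTensor (h : Π x : M, TangentSpace (𝓡 n) x →L[ℝ] TangentSpace (𝓡 n) x →L[ℝ] ℝ) (x : M)
    (v u w : TangentSpace (𝓡 n) x) : ℝ :=
  mvfderiv (𝓡 n) (fun y => h y (ext u y) (ext w y)) x v
    - h x (nabla (ext u) x v) w - h x u (nabla (ext w) x v)

/-- The weighted divergence of a symmetric 2-tensor, as a vector field:
`⟨div_f h, w⟩ = ∑ⱼ (∇_{eⱼ} h)(w, eⱼ) - h(w, ∇f)`. -/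
def divfTensor (f : M → ℝ)
    (h : Π x : M, TangentSpace (𝓡 n) x →L[ℝ] TangentSpace (𝓡 n) x →L[ℝ] ℝ) (x : M) :
    TangentSpace (𝓡 n) x :=
  ∑ i, ((∑ j, nablaTensor h x (frame x j) (frame x i) (frame x j))
    - h x (frame x i) (grad f x)) • frame x i

/-- The symmetric 2-tensor `(div_f^* Y)(u,w) = -(1/2) (⟨∇_u Y, w⟩ + ⟨∇_w Y, u⟩)`. It does not
depend on `f`. -/
def divAdjoint (Y : Π x : M, TangentSpace (𝓡 n) x) (x : M) :
    TangentSpace (𝓡 n) x →L[ℝ] TangentSpace (𝓡 n) x →L[ℝ] ℝ :=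
  let B : TangentSpace (𝓡 n) x →L[ℝ] TangentSpace (𝓡 n) x →L[ℝ] ℝ :=
    (innerSL ℝ : TangentSpace (𝓡 n) x →L[ℝ] TangentSpace (𝓡 n) x →L[ℝ] ℝ).comp (nabla Y x)
  (-1 / 2 : ℝ) • (B + B.flip)

/-- The operator `𝓟 = div_f ∘ div_f^*` on vector fields. -/
def opP (f : M → ℝ) (Y : Π x : M, TangentSpace (𝓡 n) x) : Π x : M, TangentSpace (𝓡 n) x :=
  divfTensor f (divAdjoint Y)

end RicciSoliton

end

/-! Expanding the definitions gives `𝓟 Y = -½ (𝓛 Y + div_f (∇Y)ᵀ)`, where `(∇Y)ᵀ` is the transpose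
of `∇Y`. Commuting second covariant derivatives turns `div_f (∇Y)ᵀ` into `∇ div_f Y` plus the
contraction of `Ric + Hess_f` with `Y`, and the soliton equation makes the latter `κ Y`
(`divTranspose_eq`). So `𝓟 = -½ (𝓛 + ∇ div_f + κ)`, and the first identity reduces to `𝓛 ∇ div_f = ∇
div_f 𝓛` (`drift_gr_dv`).

This rests on two facts that hold for every weight `f`. (1) The Hessian of a function `u` is its own
transpose, so `𝓛 ∇u = div_f (∇∇u)ᵀ` (`drift_gr_eq_divTranspose`). (2) `𝓛 Y - div_f (∇Y)ᵀ` is the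
weighted divergence of an antisymmetric tensor, so its own weighted divergence vanishes
(`dv_drift_sub_divTranspose`). With `u = div_f Y` and the soliton equation, `𝓛 ∇u = ∇ (div_f ∇u + κ
u) = ∇ div_f (∇u + κ Y) = ∇ div_f div_f (∇Y)ᵀ = ∇ div_f 𝓛 Y`.

In the second identity both sides equal `-∇ div_f 𝓛 Y`: fact (1) gives `𝓟 ∇u = -𝓛 ∇u`, and fact (2)
gives `div_f 𝓟 Y = -div_f 𝓛 Y`.

These computations take place on an open subset of a vector space carrying a field `g` of inner
products. The operators on `M`, defined by pointwise frames and local extensions, are then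
identified with the coordinate operators in a chart. -/

noncomputable section

/-! ### Riemannian geometry in coordinates. -/

namespace LocalMetric

-- The norm of `E` is fixed and the metric enters only as the field `g`, so the norms that a
-- Riemannian bundle puts on its fibres are switched off.
attribute [-instance]
  Bundle.instNormedAddCommGroupOfRiemannianBundleOfIsTopologicalAddGroupOfContinuousConstSMulReal
  Bundle.instInnerProductSpaceReal

variable {E : Type*} [NormedAddCommGroup E] [NormedSpace ℝ E]

local instance : NormedAddCommGroup (E →L[ℝ] E →L[ℝ] ℝ) := inferInstance
local instance : NormedSpace ℝ (E →L[ℝ] E →L[ℝ] ℝ) := inferInstance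
local instance : NormedAddCommGroup (E →L[ℝ] E →L[ℝ] E →L[ℝ] ℝ) := inferInstance
local instance : NormedSpace ℝ (E →L[ℝ] E →L[ℝ] E →L[ℝ] ℝ) := inferInstance

/-- A Riemannian metric on an open subset of a vector space. -/
structure IsMetricOn (g : E → E →L[ℝ] E →L[ℝ] ℝ) (U : Set E) : Prop where
  isOpen : IsOpen U
  smooth : ContDiffOn ℝ ∞ g U
  symm : ∀ y ∈ U, ∀ v w, g y v w = g y w v
  pos : ∀ y ∈ U, ∀ v, v ≠ 0 → 0 < g y v v

/-- The trace as a continuous linear functional on endomorphisms. -/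
def tr [FiniteDimensional ℝ E] : (E →L[ℝ] E) →L[ℝ] ℝ :=
  LinearMap.toContinuousLinearMap (LinearMap.trace ℝ E ∘ₗ ContinuousLinearMap.coeLM ℝ)

/-- The basis vectors of a fixed basis of `E`. -/
def vec [FiniteDimensional ℝ E] (i : Fin (Module.finrank ℝ E)) : E := Module.finBasis ℝ E i

/-- The coordinate functionals dual to `vec`. -/
def cov [FiniteDimensional ℝ E] (i : Fin (Module.finrank ℝ E)) : E →L[ℝ] ℝ :=
  LinearMap.toContinuousLinearMap ((Module.finBasis ℝ E).coord i)

/-- The isomorphism from covectors to vectors given by the metric. -/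
def sharp (g : E → E →L[ℝ] E →L[ℝ] ℝ) (y : E) : (E →L[ℝ] ℝ) →L[ℝ] E := (g y).inverse

/-- The Christoffel symbols of the first kind. -/
def christoffelFst (g : E → E →L[ℝ] E →L[ℝ] ℝ) (y : E) : E →L[ℝ] E →L[ℝ] E →L[ℝ] ℝ :=
  (1 / 2 : ℝ) • (fderiv ℝ g y + (fderiv ℝ g y).flip -
    (ContinuousLinearMap.flipₗᵢ ℝ E E ℝ).toContinuousLinearEquiv.toContinuousLinearMap ∘L
      (fderiv ℝ g y).flip)

/-- The Christoffel symbols of the second kind. -/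
def christoffel (g : E → E →L[ℝ] E →L[ℝ] ℝ) (y : E) : E →L[ℝ] E →L[ℝ] E :=
  (ContinuousLinearMap.compL ℝ E (E →L[ℝ] ℝ) E (sharp g y)) ∘L christoffelFst g y

/-- The Levi-Civita covariant derivative of a vector field. -/
def nab (g : E → E →L[ℝ] E →L[ℝ] ℝ) (Y : E → E) (y : E) : E →L[ℝ] E :=
  fderiv ℝ Y y + (christoffel g y).flip (Y y)

/-- The second covariant derivative as a bilinear map. -/
def hessian (g : E → E →L[ℝ] E →L[ℝ] ℝ) (Y : E → E) (y : E) : E →L[ℝ] E →L[ℝ] E :=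
  fderiv ℝ (nab g Y) y
    + (ContinuousLinearMap.compL ℝ E E E).flip (nab g Y y) ∘L christoffel g y
    - (ContinuousLinearMap.compL ℝ E E E (nab g Y y)) ∘L christoffel g y

/-- The gradient. -/
def gr (g : E → E →L[ℝ] E →L[ℝ] ℝ) (u : E → ℝ) (y : E) : E := sharp g y (fderiv ℝ u y)

/-- The Riemann curvature. -/
def curv (g : E → E →L[ℝ] E →L[ℝ] ℝ) (y u v w : E) : E :=
  fderiv ℝ (christoffel g) y u v w - fderiv ℝ (christoffel g) y v u w
    + christoffel g y u (christoffel g y v w) - christoffel g y v (christoffel g y u w)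

@[simp]
theorem hessian_apply (g : E → E →L[ℝ] E →L[ℝ] ℝ) (Y : E → E) (y v w : E) :
    hessian g Y y v w = fderiv ℝ (nab g Y) y v w + christoffel g y v (nab g Y y w)
      - nab g Y y (christoffel g y v w) := rfl

@[simp]
theorem nab_apply (g : E → E →L[ℝ] E →L[ℝ] ℝ) (Y : E → E) (y v : E) :
    nab g Y y v = fderiv ℝ Y y v + christoffel g y v (Y y) := rfl

theorem christoffelFst_apply (g : E → E →L[ℝ] E →L[ℝ] ℝ) (y u v w : E) :
    christoffelFst g y u v w =
      (1 / 2) * (fderiv ℝ g y u v w + fderiv ℝ g y v u w - fderiv ℝ g y w u v) := rfl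

theorem christoffel_apply (g : E → E →L[ℝ] E →L[ℝ] ℝ) (y u v : E) :
    christoffel g y u v = sharp g y (christoffelFst g y u v) := rfl

theorem curv_add_left (g : E → E →L[ℝ] E →L[ℝ] ℝ) (y u u' v w : E) :
    curv g y (u + u') v w = curv g y u v w + curv g y u' v w := by
  simp only [curv, map_add, add_apply]
  abel

theorem curv_smul_left (g : E → E →L[ℝ] E →L[ℝ] ℝ) (y : E) (c : ℝ) (u v w : E) :
    curv g y (c • u) v w = c • curv g y u v w := by
  simp only [curv, map_smul, smul_apply, smul_add, smul_sub]

/-! ### Symmetry, locality and linearity of the connection. -/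

namespace IsMetricOn

variable {g : E → E →L[ℝ] E →L[ℝ] ℝ} {U : Set E} (hg : IsMetricOn g U)
include hg

theorem mono {V : Set E} (hV : IsOpen V) (hVU : V ⊆ U) : IsMetricOn g V :=
  ⟨hV, hg.smooth.mono hVU, fun y hy => hg.symm y (hVU hy), fun y hy => hg.pos y (hVU hy)⟩

theorem contDiffAt {F : Type*} [NormedAddCommGroup F] [NormedSpace ℝ F] {u : E → F}
    (hu : ContDiffOn ℝ ∞ u U) {y : E} (hy : y ∈ U) : ContDiffAt ℝ ∞ u y :=
  hu.contDiffAt (hg.isOpen.mem_nhds hy)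

theorem differentiableAt {F : Type*} [NormedAddCommGroup F] [NormedSpace ℝ F] {u : E → F}
    (hu : ContDiffOn ℝ ∞ u U) {y : E} (hy : y ∈ U) : DifferentiableAt ℝ u y :=
  (hg.contDiffAt hu hy).differentiableAt (by simp)

theorem contDiffOn_fderiv {F : Type*} [NormedAddCommGroup F] [NormedSpace ℝ F] {u : E → F}
    (hu : ContDiffOn ℝ ∞ u U) : ContDiffOn ℝ ∞ (fderiv ℝ u) U :=
  hu.fderiv_of_isOpen hg.isOpen (by simp)

theorem fderiv_congr {F : Type*} [NormedAddCommGroup F] [NormedSpace ℝ F] {u v : E → F}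
    (h : ∀ y ∈ U, u y = v y) {y : E} (hy : y ∈ U) : fderiv ℝ u y = fderiv ℝ v y :=
  Filter.EventuallyEq.fderiv_eq (Filter.eventually_of_mem (hg.isOpen.mem_nhds hy) h)

theorem fderiv_fderiv_symm {F : Type*} [NormedAddCommGroup F] [NormedSpace ℝ F] {u : E → F}
    (hu : ContDiffOn ℝ ∞ u U) {y : E} (hy : y ∈ U) (v w : E) :
    fderiv ℝ (fderiv ℝ u) y v w = fderiv ℝ (fderiv ℝ u) y w v :=
  ((hg.contDiffAt hu hy).isSymmSndFDerivAt (by simp; norm_cast)).eq v w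

theorem fderiv_symm {y : E} (hy : y ∈ U) (u v w : E) :
    fderiv ℝ g y u v w = fderiv ℝ g y u w v := by
  have hd := hg.differentiableAt hg.smooth hy
  have h1 : ∀ a b : E, fderiv ℝ (fun z => g z a b) y u = fderiv ℝ g y u a b := fun a b => by
    rw [fderiv_clm_apply (by fun_prop) (by fun_prop)]
    simp [fderiv_clm_apply hd (differentiableAt_const a)]
  rw [← h1, ← h1, hg.fderiv_congr (fun z hz => hg.symm z hz v w) hy]

theorem christoffel_symm {y : E} (hy : y ∈ U) (u v : E) :
    christoffel g y u v = christoffel g y v u := by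
  simp only [christoffel_apply]
  congr 1
  ext w
  simp only [christoffelFst_apply, hg.fderiv_symm hy w u v]
  ring

theorem contDiffOn_christoffelFst : ContDiffOn ℝ ∞ (christoffelFst g) U := by
  have h := hg.contDiffOn_fderiv hg.smooth
  have h' : ContDiffOn ℝ ∞ (fun y => (fderiv ℝ g y).flip) U :=
    (ContinuousLinearMap.flipₗᵢ ℝ E E (E →L[ℝ] ℝ)).contDiff.comp_contDiffOn h
  unfold christoffelFst
  exact (contDiffOn_const (c := (1 / 2 : ℝ))).smul ((h.add h').sub
    ((contDiffOn_const (c := (ContinuousLinearMap.flipₗᵢ ℝ E E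
      ℝ).toContinuousLinearEquiv.toContinuousLinearMap)).clm_comp h'))

/-- Because `U` is open, a formula known only on `U` may be substituted under the derivative.
Iterated operators are computed this way. -/
theorem nab_congr {Y Z : E → E} (h : ∀ y ∈ U, Y y = Z y) {y : E} (hy : y ∈ U) :
    nab g Y y = nab g Z y := by
  rw [nab, nab, hg.fderiv_congr h hy, h y hy]

theorem hessian_congr {Y Z : E → E} (h : ∀ y ∈ U, Y y = Z y) {y : E} (hy : y ∈ U) :
    hessian g Y y = hessian g Z y := by
  rw [hessian, hessian, hg.fderiv_congr (fun z hz => hg.nab_congr h hz) hy, hg.nab_congr h hy]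

theorem gr_congr {u v : E → ℝ} (h : ∀ y ∈ U, u y = v y) {y : E} (hy : y ∈ U) :
    gr g u y = gr g v y := by
  rw [gr, gr, hg.fderiv_congr h hy]

theorem nab_add_smul {Y Z : E → E} (hY : ContDiffOn ℝ ∞ Y U) (hZ : ContDiffOn ℝ ∞ Z U) (c : ℝ)
    {y : E} (hy : y ∈ U) : nab g (fun z => Y z + c • Z z) y = nab g Y y + c • nab g Z y := by
  have h1 := hg.differentiableAt hY hy
  have h2 := hg.differentiableAt hZ hy
  rw [nab, nab, nab, fderiv_fun_add h1 (by fun_prop), fderiv_fun_const_smul h2, map_add, map_smul,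
    smul_add]
  abel

theorem gr_add_mul {u v : E → ℝ} (hu : ContDiffOn ℝ ∞ u U) (hv : ContDiffOn ℝ ∞ v U) (c : ℝ)
    {y : E} (hy : y ∈ U) : gr g (fun z => u z + c * v z) y = gr g u y + c • gr g v y := by
  have h1 := hg.differentiableAt hu hy
  have h2 := hg.differentiableAt hv hy
  rw [gr, gr, gr, fderiv_fun_add h1 (by fun_prop), fderiv_const_mul h2, map_add, map_smul]

end IsMetricOn

/-- In coordinates: the double weighted divergence of an antisymmetric bivector field vanishes, if
the weight is the logarithmic derivative of a density. -/
theorem sum_fderiv_add_mul_eq_zero {ι : Type*} [Fintype ι] (e : ι → E) {U : Set E} (hU : IsOpen U)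
    {B : ι → ι → E → ℝ} (hB : ∀ a c, ContDiffOn ℝ ∞ (B a c) U)
    (hanti : ∀ a c, ∀ y ∈ U, B a c y = -B c a y)
    {r : ι → E → ℝ} (hr : ∀ a, ContDiffOn ℝ ∞ (r a) U)
    (hclosed : ∀ a c, ∀ y ∈ U, fderiv ℝ (r a) y (e c) = fderiv ℝ (r c) y (e a))
    {Z : ι → E → ℝ}
    (hZ : ∀ c, ∀ y ∈ U, Z c y = ∑ a, (fderiv ℝ (B a c) y (e a) + r a y * B a c y))
    {y : E} (hy : y ∈ U) : ∑ c, (fderiv ℝ (Z c) y (e c) + r c y * Z c y) = 0 := by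
  have hn := hU.mem_nhds hy
  have hBd : ∀ a c, DifferentiableAt ℝ (B a c) y := fun a c =>
    ((hB a c).contDiffAt hn).differentiableAt (by simp)
  have hBd' : ∀ a c, DifferentiableAt ℝ (fderiv ℝ (B a c)) y := fun a c =>
    (((hB a c).fderiv_of_isOpen hU (m := ∞) (by simp)).contDiffAt hn).differentiableAt (by simp)
  have hrd : ∀ a, DifferentiableAt ℝ (r a) y := fun a =>
    ((hr a).contDiffAt hn).differentiableAt (by simp)
  have hBs : ∀ a c v w,
      fderiv ℝ (fderiv ℝ (B a c)) y v w = fderiv ℝ (fderiv ℝ (B a c)) y w v := fun a c v w =>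
    (((hB a c).contDiffAt hn).isSymmSndFDerivAt (by simp; norm_cast)).eq v w
  have hcongr : ∀ {u v : E → ℝ}, (∀ z ∈ U, u z = v z) → fderiv ℝ u y = fderiv ℝ v y :=
    fun h => Filter.EventuallyEq.fderiv_eq (Filter.eventually_of_mem hn h)
  have hanti1 : ∀ a c, ∀ z ∈ U, fderiv ℝ (B a c) z = -fderiv ℝ (B c a) z := fun a c z hz => by
    rw [← fderiv_neg]
    exact Filter.EventuallyEq.fderiv_eq (Filter.eventually_of_mem (hU.mem_nhds hz) (hanti a c))
  have hanti2 : ∀ a c, fderiv ℝ (fderiv ℝ (B a c)) y = -fderiv ℝ (fderiv ℝ (B c a)) y :=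
    fun a c => by
      rw [← fderiv_neg]
      exact Filter.EventuallyEq.fderiv_eq (Filter.eventually_of_mem hn (hanti1 a c))
  have hZd : ∀ c, fderiv ℝ (Z c) y (e c) = ∑ a, (fderiv ℝ (fderiv ℝ (B a c)) y (e c) (e a)
      + (r a y * fderiv ℝ (B a c) y (e c) + B a c y * fderiv ℝ (r a) y (e c))) := fun c => by
    rw [hcongr (hZ c), fderiv_fun_sum (fun a _ => by fun_prop), sum_apply]
    refine Finset.sum_congr rfl fun a _ => ?_
    rw [fderiv_fun_add (by fun_prop) (by fun_prop), fderiv_clm_apply (hBd' a c) (by fun_prop),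
      fderiv_fun_mul (hrd a) (hBd a c)]
    simp
  have hterm : ∀ c, fderiv ℝ (Z c) y (e c) + r c y * Z c y =
      ∑ a, (fderiv ℝ (fderiv ℝ (B a c)) y (e c) (e a)
        + (r a y * fderiv ℝ (B a c) y (e c) + B a c y * fderiv ℝ (r a) y (e c))
        + r c y * (fderiv ℝ (B a c) y (e a) + r a y * B a c y)) := fun c => by
    rw [hZd, hZ c y hy, Finset.mul_sum, ← Finset.sum_add_distrib]
  set S := ∑ c, (fderiv ℝ (Z c) y (e c) + r c y * Z c y) with hS
  -- Exchanging `a` and `c` negates each summand: second derivatives commute, `∂_c r_a` and `r_c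
  -- r_a` are symmetric, the two cross terms trade places, and `B` changes sign.
  have hS' : S = -S := by
    conv_lhs => rw [hS, Finset.sum_congr rfl fun c _ => hterm c, Finset.sum_comm]
    rw [hS, Finset.sum_congr rfl fun c _ => hterm c, ← Finset.sum_neg_distrib]
    refine Finset.sum_congr rfl fun a _ => ?_
    rw [← Finset.sum_neg_distrib]
    refine Finset.sum_congr rfl fun c _ => ?_
    rw [hanti2 a c, hanti1 a c y hy, hanti a c y hy, hclosed a c y hy]
    simp only [neg_apply, hBs c a (e c) (e a)]
    ring
  linarith

/-! ### Traces, raising of indices and the weighted operators. -/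

variable [FiniteDimensional ℝ E]

/-- The Ricci curvature. -/
def ric (g : E → E →L[ℝ] E →L[ℝ] ℝ) (y v w : E) : ℝ :=
  ∑ i, cov i (curv g y (vec i) v w)

/-- The drift Laplacian. -/
def drift (g : E → E →L[ℝ] E →L[ℝ] ℝ) (f : E → ℝ) (Y : E → E) (y : E) : E :=
  ∑ i, hessian g Y y (vec i) (sharp g y (cov i)) - nab g Y y (gr g f y)

/-- The weighted divergence of a vector field. -/
def dv (g : E → E →L[ℝ] E →L[ℝ] ℝ) (f : E → ℝ) (Y : E → E) (y : E) : ℝ :=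
  tr (nab g Y y) - fderiv ℝ f y (Y y)

/-- The weighted divergence of the transpose of the covariant derivative. -/
def divTranspose (g : E → E →L[ℝ] E →L[ℝ] ℝ) (f : E → ℝ) (Y : E → E) (y : E) : E :=
  sharp g y (tr ∘L (hessian g Y y).flip - fderiv ℝ f y ∘L nab g Y y)

/-- The operator `div_f div_f^*`. -/
def op (g : E → E →L[ℝ] E →L[ℝ] ℝ) (f : E → ℝ) (Y : E → E) (y : E) : E :=
  (-1 / 2 : ℝ) • (drift g f Y y + divTranspose g f Y y)

theorem tr_eq_sum (A : E →L[ℝ] E) : tr A = ∑ i, cov i (A (vec i)) := by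
  simp [tr, LinearMap.trace_eq_matrix_trace ℝ (Module.finBasis ℝ E), Matrix.trace, cov, vec,
    LinearMap.toMatrix_apply]

theorem tr_comp_comm (A B : E →L[ℝ] E) : tr (A ∘L B) = tr (B ∘L A) := by
  exact LinearMap.trace_mul_comm ℝ (A : E →ₗ[ℝ] E) (B : E →ₗ[ℝ] E)

theorem sum_cov_smul_vec (v : E) : ∑ i, cov i v • vec i = v := by
  simp [cov, vec]

theorem sum_apply_vec_smul_cov (l : E →L[ℝ] ℝ) : ∑ i, l (vec i) • cov i = l := by
  ext v
  conv_rhs => rw [← sum_cov_smul_vec v]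
  simp [mul_comm]

namespace IsMetricOn

variable {g : E → E →L[ℝ] E →L[ℝ] ℝ} {U : Set E} (hg : IsMetricOn g U)
include hg

theorem isInvertible {y : E} (hy : y ∈ U) : (g y).IsInvertible := by
  have hinj : Function.Injective (g y : E →ₗ[ℝ] (E →L[ℝ] ℝ)) := by
    rw [← LinearMap.ker_eq_bot, LinearMap.ker_eq_bot']
    intro v hv
    by_contra hne
    have h := hg.pos y hy v hne
    have : g y v = 0 := hv
    simp [this] at h
  have hdim : Module.finrank ℝ E = Module.finrank ℝ (E →L[ℝ] ℝ) := by
    rw [← (LinearMap.toContinuousLinearMap (𝕜 := ℝ) (E := E) (F' := ℝ)).finrank_eq]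
    exact (Subspace.dual_finrank_eq (K := ℝ) (V := E)).symm
  exact ⟨(LinearEquiv.ofInjectiveOfFinrankEq _ hinj hdim).toContinuousLinearEquiv, by ext; rfl⟩

theorem apply_sharp {y : E} (hy : y ∈ U) (l : E →L[ℝ] ℝ) : g y (sharp g y l) = l := by
  obtain ⟨e, he⟩ := hg.isInvertible hy
  simp [sharp, ← he]

theorem sharp_apply {y : E} (hy : y ∈ U) (v : E) : sharp g y (g y v) = v := by
  obtain ⟨e, he⟩ := hg.isInvertible hy
  simp [sharp, ← he]

theorem apply_sharp' {y : E} (hy : y ∈ U) (v : E) (l : E →L[ℝ] ℝ) :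
    g y v (sharp g y l) = l v := by
  rw [hg.symm y hy, hg.apply_sharp hy]

theorem sharp_symm {y : E} (hy : y ∈ U) (l m : E →L[ℝ] ℝ) :
    l (sharp g y m) = m (sharp g y l) := by
  rw [← hg.apply_sharp' hy (sharp g y m) l, hg.apply_sharp hy]

theorem ext_apply {y : E} (hy : y ∈ U) {v w : E} (h : ∀ z, g y v z = g y w z) : v = w := by
  rw [← hg.sharp_apply hy v, ← hg.sharp_apply hy w, ContinuousLinearMap.ext h]

theorem contDiffOn_sharp : ContDiffOn ℝ ∞ (sharp g) U := fun y hy =>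
  ((hg.isInvertible hy).contDiffAt_map_inverse).comp_contDiffWithinAt y (hg.smooth y hy)

theorem contDiffOn_christoffel : ContDiffOn ℝ ∞ (christoffel g) U := by
  unfold christoffel
  exact ((ContinuousLinearMap.compL ℝ E (E →L[ℝ] ℝ) E).contDiff.comp_contDiffOn
    hg.contDiffOn_sharp).clm_comp hg.contDiffOn_christoffelFst

theorem apply_christoffel {y : E} (hy : y ∈ U) (u v w : E) :
    g y (christoffel g y u v) w = christoffelFst g y u v w := by
  rw [christoffel_apply, hg.apply_sharp hy]

/-- Metric compatibility, `∇g = 0`: in the sum of the two symbols of the first kind the other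
derivatives of `g` cancel. -/
theorem fderiv_eq_christoffel {y : E} (hy : y ∈ U) (u v w : E) :
    fderiv ℝ g y u v w = g y (christoffel g y u v) w + g y v (christoffel g y u w) := by
  rw [hg.symm y hy v, hg.apply_christoffel hy, hg.apply_christoffel hy, christoffelFst_apply,
    christoffelFst_apply, hg.fderiv_symm hy u w v, hg.fderiv_symm hy v u w,
    hg.fderiv_symm hy w u v]
  ring

theorem contDiffOn_nab {Y : E → E} (hY : ContDiffOn ℝ ∞ Y U) : ContDiffOn ℝ ∞ (nab g Y) U := by
  unfold nab
  exact (hg.contDiffOn_fderiv hY).add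
    (((ContinuousLinearMap.flipₗᵢ ℝ E E E).contDiff.comp_contDiffOn
      hg.contDiffOn_christoffel).clm_apply hY)

theorem contDiffOn_hessian {Y : E → E} (hY : ContDiffOn ℝ ∞ Y U) :
    ContDiffOn ℝ ∞ (hessian g Y) U := by
  have h1 := hg.contDiffOn_nab hY
  have h2 := hg.contDiffOn_christoffel
  unfold hessian
  exact ((hg.contDiffOn_fderiv h1).add
    (((ContinuousLinearMap.compL ℝ E E E).flip.contDiff.comp_contDiffOn h1).clm_comp h2)).sub
    (((ContinuousLinearMap.compL ℝ E E E).contDiff.comp_contDiffOn h1).clm_comp h2)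

theorem contDiffOn_gr {u : E → ℝ} (hu : ContDiffOn ℝ ∞ u U) : ContDiffOn ℝ ∞ (gr g u) U :=
  hg.contDiffOn_sharp.clm_apply (hg.contDiffOn_fderiv hu)

theorem contDiffOn_drift {f : E → ℝ} (hf : ContDiffOn ℝ ∞ f U) {Y : E → E}
    (hY : ContDiffOn ℝ ∞ Y U) : ContDiffOn ℝ ∞ (drift g f Y) U := by
  have h1 := hg.contDiffOn_nab hY
  have h2 := hg.contDiffOn_hessian hY
  have h3 := hg.contDiffOn_sharp
  have h4 := hg.contDiffOn_gr hf
  unfold drift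
  fun_prop

theorem contDiffOn_dv {f : E → ℝ} (hf : ContDiffOn ℝ ∞ f U) {Y : E → E}
    (hY : ContDiffOn ℝ ∞ Y U) : ContDiffOn ℝ ∞ (dv g f Y) U := by
  have h1 := hg.contDiffOn_nab hY
  have h2 := hg.contDiffOn_fderiv hf
  unfold dv
  fun_prop

end IsMetricOn

/-! ### The Ricci identity and the consequences of the soliton equation. -/

namespace IsMetricOn

variable {g : E → E →L[ℝ] E →L[ℝ] ℝ} {U : Set E} (hg : IsMetricOn g U)
include hg

/-- The inverse metric is parallel as well; this comes from differentiating `g (sharp l) = l` for a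
constant covector. -/
theorem fderiv_sharp {y : E} (hy : y ∈ U) (v : E) (l : E →L[ℝ] ℝ) :
    fderiv ℝ (sharp g) y v l =
      -christoffel g y v (sharp g y l) - sharp g y (l ∘L christoffel g y v) := by
  have hd := hg.differentiableAt hg.smooth hy
  have hs := hg.differentiableAt hg.contDiffOn_sharp hy
  have h0 : fderiv ℝ (fun z => g z (sharp g z l)) y = 0 := by
    rw [hg.fderiv_congr (fun z hz => hg.apply_sharp hz l) hy]
    simp
  refine hg.ext_apply hy fun w => ?_
  have h1 := congr($h0 v w)
  rw [fderiv_clm_apply hd (by fun_prop), fderiv_clm_apply hs (by fun_prop)] at h1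
  simp only [add_apply, ContinuousLinearMap.comp_apply,
    ContinuousLinearMap.flip_apply, fderiv_fun_const, Pi.zero_apply,
    zero_apply, map_zero, zero_add,
    hg.fderiv_eq_christoffel hy, hg.apply_sharp hy] at h1
  simp only [map_sub, map_neg, sub_apply, neg_apply,
    hg.apply_sharp hy, ContinuousLinearMap.comp_apply]
  linarith

theorem fderiv_nab {Y : E → E} (hY : ContDiffOn ℝ ∞ Y U) {y : E} (hy : y ∈ U) (v w : E) :
    fderiv ℝ (nab g Y) y v w = fderiv ℝ (fderiv ℝ Y) y v w + fderiv ℝ (christoffel g) y v w (Y y)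
      + christoffel g y w (fderiv ℝ Y y v) := by
  have h1 := hg.differentiableAt (hg.contDiffOn_nab hY) hy
  have h2 := hg.differentiableAt (hg.contDiffOn_fderiv hY) hy
  have h3 := hg.differentiableAt hg.contDiffOn_christoffel hy
  have h4 := hg.differentiableAt hY hy
  have h : fderiv ℝ (nab g Y) y v w = fderiv ℝ (fun z => nab g Y z w) y v := by
    rw [fderiv_clm_apply h1 (differentiableAt_const w)]
    simp
  have h' : (fun z => nab g Y z w) = fun z => fderiv ℝ Y z w + christoffel g z w (Y z) := rfl
  rw [h, h', fderiv_fun_add (by fun_prop) (by fun_prop), fderiv_clm_apply h2 (by fun_prop),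
    fderiv_clm_apply (by fun_prop) h4, fderiv_clm_apply h3 (by fun_prop)]
  simp
  abel

/-- The Ricci identity: torsion-freeness removes the first-order terms, and only curvature remains.
-/
theorem hessian_sub_hessian {Y : E → E} (hY : ContDiffOn ℝ ∞ Y U) {y : E} (hy : y ∈ U)
    (u v : E) : hessian g Y y u v - hessian g Y y v u = curv g y u v (Y y) := by
  simp only [hessian_apply, hg.fderiv_nab hY hy, nab_apply, curv, map_add,
    hg.fderiv_fderiv_symm hY hy v u, hg.christoffel_symm hy v u]
  abel

/-- Traces commute with covariant derivatives, since the Christoffel terms form a commutator and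
have trace zero. -/
theorem fderiv_tr_nab {Y : E → E} (hY : ContDiffOn ℝ ∞ Y U) {y : E} (hy : y ∈ U) (w : E) :
    fderiv ℝ (fun z => tr (nab g Y z)) y w = tr (hessian g Y y w) := by
  have h1 := hg.differentiableAt (hg.contDiffOn_nab hY) hy
  have h : hessian g Y y w = fderiv ℝ (nab g Y) y w + christoffel g y w ∘L nab g Y y
      - nab g Y y ∘L christoffel g y w := rfl
  have h2 : fderiv ℝ (fun z => tr (nab g Y z)) y = tr ∘L fderiv ℝ (nab g Y) y :=
    ((tr (E := E)).hasFDerivAt.comp y h1.hasFDerivAt).fderiv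
  rw [h, h2, map_sub, map_add, tr_comp_comm (nab g Y y)]
  simp

theorem tr_hessian_flip {Y : E → E} (hY : ContDiffOn ℝ ∞ Y U) {y : E} (hy : y ∈ U) (w : E) :
    tr ((hessian g Y y).flip w) = fderiv ℝ (fun z => tr (nab g Y z)) y w + ric g y w (Y y) := by
  rw [hg.fderiv_tr_nab hY hy, tr_eq_sum, tr_eq_sum, ric, ← Finset.sum_add_distrib]
  refine Finset.sum_congr rfl fun i _ => ?_
  rw [← hg.hessian_sub_hessian hY hy, map_sub]
  simp

theorem apply_gr {u : E → ℝ} {y : E} (hy : y ∈ U) (w : E) :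
    g y (gr g u y) w = fderiv ℝ u y w := by
  rw [gr, hg.apply_sharp hy]

theorem apply_nab_gr {u : E → ℝ} (hu : ContDiffOn ℝ ∞ u U) {y : E} (hy : y ∈ U) (v w : E) :
    g y (nab g (gr g u) y v) w =
      fderiv ℝ (fderiv ℝ u) y v w - fderiv ℝ u y (christoffel g y v w) := by
  have h1 := hg.differentiableAt hg.contDiffOn_sharp hy
  have h2 := hg.differentiableAt (hg.contDiffOn_fderiv hu) hy
  have h3 : fderiv ℝ (gr g u) y v = sharp g y (fderiv ℝ (fderiv ℝ u) y v) +
      fderiv ℝ (sharp g) y v (fderiv ℝ u y) := by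
    have h : gr g u = fun z => sharp g z (fderiv ℝ u z) := rfl
    rw [h, fderiv_clm_apply h1 h2]
    rfl
  rw [nab_apply, h3, hg.fderiv_sharp hy]
  simp [hg.apply_sharp hy, gr]
  ring

theorem apply_nab_gr_symm {u : E → ℝ} (hu : ContDiffOn ℝ ∞ u U) {y : E} (hy : y ∈ U) (v w : E) :
    g y (nab g (gr g u) y v) w = g y (nab g (gr g u) y w) v := by
  rw [hg.apply_nab_gr hu hy, hg.apply_nab_gr hu hy, hg.fderiv_fderiv_symm hu hy,
    hg.christoffel_symm hy]

/-- The Leibniz rule for `⟨∇_A Y, B⟩`, with all Christoffel terms absorbed by metric compatibility.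
-/
theorem fderiv_apply_nab {Y A B : E → E} (hY : ContDiffOn ℝ ∞ Y U) {y : E}
    (hA : DifferentiableAt ℝ A y) (hB : DifferentiableAt ℝ B y) (hy : y ∈ U) (v : E) :
    fderiv ℝ (fun z => g z (nab g Y z (A z)) (B z)) y v = g y (hessian g Y y v (A y)) (B y)
      + g y (nab g Y y (nab g A y v)) (B y) + g y (nab g Y y (A y)) (nab g B y v) := by
  have h1 := hg.differentiableAt (hg.contDiffOn_nab hY) hy
  have h2 := hg.differentiableAt hg.smooth hy
  rw [fderiv_clm_apply (by fun_prop) hB, fderiv_clm_apply h2 (by fun_prop),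
    fderiv_clm_apply h1 hA]
  simp only [hessian_apply, add_apply, ContinuousLinearMap.comp_apply,
    ContinuousLinearMap.flip_apply, map_add, map_sub, sub_apply, hg.fderiv_eq_christoffel hy,
    nab_apply g A, nab_apply g B]
  ring

/-- Differentiate the symmetry of the Hessian on constant vectors; the correction terms match by
that same symmetry. -/
theorem hessian_gr_symm {u : E → ℝ} (hu : ContDiffOn ℝ ∞ u U) {y : E} (hy : y ∈ U)
    (v a b : E) :
    g y (hessian g (gr g u) y v a) b = g y (hessian g (gr g u) y v b) a := by
  have hY := hg.contDiffOn_gr hu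
  have h := congr($(hg.fderiv_congr (fun z hz => hg.apply_nab_gr_symm hu hz a b) hy) v)
  rw [hg.fderiv_apply_nab hY (by fun_prop) (by fun_prop) hy,
    hg.fderiv_apply_nab hY (by fun_prop) (by fun_prop) hy] at h
  have hc : ∀ c, nab g (fun _ => c) y v = christoffel g y v c := fun c => by simp
  rw [hc, hc, hg.apply_nab_gr_symm hu hy (christoffel g y v a),
    hg.apply_nab_gr_symm hu hy (christoffel g y v b)] at h
  linarith

theorem drift_gr_eq_divTranspose {f u : E → ℝ} (hu : ContDiffOn ℝ ∞ u U) {y : E} (hy : y ∈ U) :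
    drift g f (gr g u) y = divTranspose g f (gr g u) y := by
  refine hg.ext_apply hy fun w => ?_
  rw [divTranspose, hg.apply_sharp hy, drift, map_sub, map_sum, sub_apply,
    sum_apply, hg.apply_nab_gr_symm hu hy]
  simp only [sub_apply, ContinuousLinearMap.comp_apply, tr_eq_sum]
  congr 1
  · refine Finset.sum_congr rfl fun i _ => ?_
    rw [hg.hessian_gr_symm hu hy, hg.apply_sharp' hy]
    simp
  · rw [gr, hg.apply_sharp' hy]

/-- Paired with `w`, the Ricci identity contributes `Ric(w, Y)`, and differentiating `⟨Y, ∇f⟩`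
leaves `Hess_f(w, Y)`. The soliton equation is used precisely on their sum. -/
theorem divTranspose_eq {f : E → ℝ} (hf : ContDiffOn ℝ ∞ f U) {κ : ℝ}
    (hsol : ∀ y ∈ U, ∀ v w, ric g y v w + g y (nab g (gr g f) y v) w = κ * g y v w)
    {Y : E → E} (hY : ContDiffOn ℝ ∞ Y U) {y : E} (hy : y ∈ U) :
    divTranspose g f Y y = gr g (dv g f Y) y + κ • Y y := by
  have h1 := hg.differentiableAt (hg.contDiffOn_nab hY) hy
  have h2 := hg.differentiableAt (hg.contDiffOn_fderiv hf) hy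
  have h3 := hg.differentiableAt hY hy
  refine hg.ext_apply hy fun w => ?_
  have h4 : fderiv ℝ (dv g f Y) y w = fderiv ℝ (fun z => tr (nab g Y z)) y w -
      (fderiv ℝ f y (fderiv ℝ Y y w) + fderiv ℝ (fderiv ℝ f) y w (Y y)) := by
    have h : dv g f Y = fun z => tr (nab g Y z) - fderiv ℝ f z (Y z) := rfl
    rw [h, fderiv_fun_sub (by fun_prop) (by fun_prop), fderiv_clm_apply h2 h3]
    rfl
  have h5 := hsol y hy w (Y y)
  rw [hg.apply_nab_gr hf hy] at h5
  rw [divTranspose, hg.apply_sharp hy, map_add, add_apply, hg.apply_gr hy, h4]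
  simp only [sub_apply, ContinuousLinearMap.comp_apply,
    hg.tr_hessian_flip hY hy, nab_apply, map_add, map_smul, smul_apply,
    smul_eq_mul]
  rw [hg.symm y hy (Y y)]
  linarith

end IsMetricOn

/-! ### The double weighted divergence of an antisymmetric tensor. -/

namespace IsMetricOn

variable {g : E → E →L[ℝ] E →L[ℝ] ℝ} {U : Set E} (hg : IsMetricOn g U)
include hg

theorem hessian_sharp {Y : E → E} (hY : ContDiffOn ℝ ∞ Y U) {y : E} (hy : y ∈ U)
    (v : E) (l : E →L[ℝ] ℝ) :
    hessian g Y y v (sharp g y l) = fderiv ℝ (fun z => nab g Y z (sharp g z l)) y v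
      + christoffel g y v (nab g Y y (sharp g y l))
      + nab g Y y (sharp g y (l ∘L christoffel g y v)) := by
  have h1 := hg.differentiableAt (hg.contDiffOn_nab hY) hy
  have h2 := hg.differentiableAt hg.contDiffOn_sharp hy
  rw [fderiv_clm_apply h1 (by fun_prop), fderiv_clm_apply h2 (by fun_prop)]
  simp only [add_apply, ContinuousLinearMap.comp_apply, hessian_apply,
    ContinuousLinearMap.flip_apply, fderiv_fun_const, Pi.zero_apply, zero_apply, map_zero,
    zero_add, hg.fderiv_sharp hy, map_sub, map_neg]
  abel

theorem sum_sharp_comm {y : E} (hy : y ∈ U) (b : E →L[ℝ] E →L[ℝ] ℝ) :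
    ∑ i, b (sharp g y (cov i)) (vec i) = ∑ i, b (vec i) (sharp g y (cov i)) := by
  have h : ∀ i, sharp g y (cov i) = ∑ j, cov j (sharp g y (cov i)) • vec j :=
    fun i => (sum_cov_smul_vec _).symm
  have h1 : ∀ i, b (sharp g y (cov i)) (vec i) =
      ∑ j, cov j (sharp g y (cov i)) * b (vec j) (vec i) := fun i => by
    conv_lhs => rw [h i]
    simp
  have h2 : ∀ i, b (vec i) (sharp g y (cov i)) =
      ∑ j, cov j (sharp g y (cov i)) * b (vec i) (vec j) := fun i => by
    conv_lhs => rw [h i]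
    simp
  simp_rw [h1, h2]
  rw [Finset.sum_comm]
  refine Finset.sum_congr rfl fun i _ => Finset.sum_congr rfl fun j _ => ?_
  rw [hg.sharp_symm hy]

theorem fderiv_sharp' {y : E} (hy : y ∈ U) (v : E) :
    fderiv ℝ (sharp g) y v = -(sharp g y ∘L (fderiv ℝ g y v ∘L sharp g y)) := by
  ext l
  rw [hg.fderiv_sharp hy]
  refine hg.ext_apply hy fun w => ?_
  simp [hg.apply_sharp hy, hg.fderiv_eq_christoffel hy]
  ring

/-- Jacobi's formula without determinants: by metric compatibility `∂_v g` splits into two terms,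
which have equal traces because the inverse metric is symmetric. -/
theorem tr_christoffel {y : E} (hy : y ∈ U) (v : E) :
    tr (christoffel g y v) = (1 / 2) * tr (sharp g y ∘L fderiv ℝ g y v) := by
  have h : ∀ i, cov i ((sharp g y ∘L fderiv ℝ g y v) (vec i)) =
      cov i (christoffel g y v (vec i)) + christoffelFst g y v (sharp g y (cov i)) (vec i) := by
    intro i
    have : fderiv ℝ g y v (vec i) = g y (christoffel g y v (vec i)) +
        (g y (vec i)) ∘L christoffel g y v := by
      ext b
      simp [hg.fderiv_eq_christoffel hy]
    rw [ContinuousLinearMap.comp_apply, this, map_add, map_add, hg.sharp_apply hy,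
      hg.sharp_symm hy, ContinuousLinearMap.comp_apply, hg.symm y hy, hg.apply_christoffel hy]
  rw [tr_eq_sum, tr_eq_sum, Finset.sum_congr rfl fun i _ => h i, Finset.sum_add_distrib,
    hg.sum_sharp_comm hy]
  simp_rw [← hg.apply_christoffel hy, hg.apply_sharp' hy]
  ring

/-- The trace of the Christoffel symbols is closed: it is the logarithmic derivative of the
Riemannian density. -/
theorem fderiv_tr_christoffel_symm {y : E} (hy : y ∈ U) (v w : E) :
    fderiv ℝ (fun z => tr (christoffel g z w)) y v =
      fderiv ℝ (fun z => tr (christoffel g z v)) y w := by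
  have hd := hg.differentiableAt (hg.contDiffOn_fderiv hg.smooth) hy
  have hs := hg.differentiableAt hg.contDiffOn_sharp hy
  -- Differentiating `½ tr (g⁻¹ ∂_a g)` gives two terms symmetric in `a` and `b`, by equality of
  -- mixed derivatives and cyclicity of the trace.
  have h : ∀ a b, fderiv ℝ (fun z => tr (christoffel g z a)) y b = (1 / 2) *
      (tr (sharp g y ∘L fderiv ℝ (fderiv ℝ g) y b a)
        - tr ((sharp g y ∘L fderiv ℝ g y b) ∘L (sharp g y ∘L fderiv ℝ g y a))) := by
    intro a b
    have h1 : HasFDerivAt (fun z => fderiv ℝ g z a) ((fderiv ℝ (fderiv ℝ g) y).flip a) y := by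
      simpa using hd.hasFDerivAt.clm_apply (hasFDerivAt_const a y)
    have h2 := (((tr (E := E)).hasFDerivAt.comp y (hs.hasFDerivAt.clm_comp h1)).const_mul
      (1 / 2 : ℝ)).fderiv
    rw [hg.fderiv_congr (fun z hz => hg.tr_christoffel hz a) hy]
    refine (congr($h2 b)).trans ?_
    simp [hg.fderiv_sharp' hy, ContinuousLinearMap.comp_assoc, sub_eq_add_neg]
    ring
  rw [h, h, hg.fderiv_fderiv_symm hg.smooth hy, tr_comp_comm (sharp g y ∘L fderiv ℝ g y v)]

/-- The index formula for the covariant derivative of `T^{ac} = ∇^a Y^c`, with one Christoffel term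
for each upper index. -/
theorem cov_hessian_sharp {Y : E → E} (hY : ContDiffOn ℝ ∞ Y U) {y : E} (hy : y ∈ U)
    (i a c : Fin (Module.finrank ℝ E)) :
    cov c (hessian g Y y (vec i) (sharp g y (cov a))) =
      fderiv ℝ (fun z => cov c (nab g Y z (sharp g z (cov a)))) y (vec i)
      + ∑ d, cov c (christoffel g y (vec i) (vec d)) * cov d (nab g Y y (sharp g y (cov a)))
      + ∑ d, cov a (christoffel g y (vec i) (vec d)) * cov c (nab g Y y (sharp g y (cov d))) := by
  have h1 := hg.differentiableAt (hg.contDiffOn_nab hY) hy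
  have h2 := hg.differentiableAt hg.contDiffOn_sharp hy
  rw [hg.hessian_sharp hY hy, map_add, map_add]
  congr 1
  · congr 1
    · have h3 : DifferentiableAt ℝ (fun z => nab g Y z (sharp g z (cov a))) y := by fun_prop
      exact congr($(((cov c).hasFDerivAt.comp y h3.hasFDerivAt).fderiv) (vec i)).symm
    · conv_lhs => rw [← sum_cov_smul_vec (nab g Y y (sharp g y (cov a)))]
      simp [mul_comm]
  · conv_lhs => rw [← sum_apply_vec_smul_cov (cov a ∘L christoffel g y (vec i))]
    simp [mul_add]

theorem contDiffOn_divTranspose {f : E → ℝ} (hf : ContDiffOn ℝ ∞ f U) {Y : E → E}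
    (hY : ContDiffOn ℝ ∞ Y U) : ContDiffOn ℝ ∞ (divTranspose g f Y) U := by
  have h : ContDiffOn ℝ ∞ (fun y => (hessian g Y y).flip) U :=
    (ContinuousLinearMap.flipₗᵢ ℝ E E E).contDiff.comp_contDiffOn (hg.contDiffOn_hessian hY)
  exact hg.contDiffOn_sharp.clm_apply ((contDiffOn_const.clm_comp h).sub
    ((hg.contDiffOn_fderiv hf).clm_comp (hg.contDiffOn_nab hY)))

/-- With `B^{ac} = ∇^a Y^c - ∇^c Y^a`, this is `∂_a B^{ac} + r_a B^{ac}` for `r_a = Γ^d_{ad} - ∂_a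
f`, the form required by `sum_fderiv_add_mul_eq_zero`. -/
theorem cov_drift_sub_divTranspose {f : E → ℝ} {Y : E → E}
    (hY : ContDiffOn ℝ ∞ Y U) {y : E} (hy : y ∈ U) (c : Fin (Module.finrank ℝ E)) :
    cov c (drift g f Y y - divTranspose g f Y y) =
      ∑ a, (fderiv ℝ (fun z => cov c (nab g Y z (sharp g z (cov a)))
          - cov a (nab g Y z (sharp g z (cov c)))) y (vec a)
        + (tr (christoffel g y (vec a)) - fderiv ℝ f y (vec a)) *
          (cov c (nab g Y y (sharp g y (cov a))) - cov a (nab g Y y (sharp g y (cov c))))) := by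
  have h1 := hg.differentiableAt (hg.contDiffOn_nab hY) hy
  have h2 := hg.differentiableAt hg.contDiffOn_sharp hy
  have hdrift : cov c (drift g f Y y) =
      ∑ a, cov c (hessian g Y y (vec a) (sharp g y (cov a))) -
        ∑ a, fderiv ℝ f y (vec a) * cov c (nab g Y y (sharp g y (cov a))) := by
    have : gr g f y = ∑ a, fderiv ℝ f y (vec a) • sharp g y (cov a) := by
      conv_lhs => rw [gr, ← sum_apply_vec_smul_cov (fderiv ℝ f y)]
      simp
    rw [drift, map_sub, map_sum, this, map_sum, map_sum]
    simp only [map_smul, smul_eq_mul]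
  have hdivT : cov c (divTranspose g f Y y) =
      ∑ a, cov a (hessian g Y y (vec a) (sharp g y (cov c))) -
        ∑ a, fderiv ℝ f y (vec a) * cov a (nab g Y y (sharp g y (cov c))) := by
    rw [divTranspose, hg.sharp_symm hy, sub_apply, ContinuousLinearMap.comp_apply, tr_eq_sum,
      ContinuousLinearMap.comp_apply]
    congr 1
    conv_lhs => rw [← sum_apply_vec_smul_cov (fderiv ℝ f y)]
    simp only [sum_apply, smul_apply, smul_eq_mul]
  have hfd : ∀ a, fderiv ℝ (fun z => cov c (nab g Y z (sharp g z (cov a)))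
      - cov a (nab g Y z (sharp g z (cov c)))) y (vec a) =
      fderiv ℝ (fun z => cov c (nab g Y z (sharp g z (cov a)))) y (vec a) -
      fderiv ℝ (fun z => cov a (nab g Y z (sharp g z (cov c)))) y (vec a) := fun a => by
    rw [fderiv_fun_sub (by fun_prop) (by fun_prop), sub_apply]
  -- The remaining term `Γ^c_{ad} B^{ad}` drops out, since `Γ` is symmetric in its lower indices.
  have hcomm1 : ∑ a, ∑ d, cov c (christoffel g y (vec a) (vec d))
        * cov a (nab g Y y (sharp g y (cov d))) =
      ∑ a, ∑ d, cov c (christoffel g y (vec a) (vec d))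
        * cov d (nab g Y y (sharp g y (cov a))) := by
    rw [Finset.sum_comm]
    simp_rw [hg.christoffel_symm hy]
  have hcomm2 : ∀ F : Fin (Module.finrank ℝ E) → ℝ,
      ∑ a, ∑ d, cov a (christoffel g y (vec a) (vec d)) * F d =
        ∑ a, tr (christoffel g y (vec a)) * F a := fun F => by
    rw [Finset.sum_comm]
    refine Finset.sum_congr rfl fun a _ => ?_
    rw [tr_eq_sum, Finset.sum_mul]
    simp_rw [hg.christoffel_symm hy (vec a)]
  rw [map_sub, hdrift, hdivT]
  simp_rw [hg.cov_hessian_sharp hY hy, hfd, sub_mul, mul_sub]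
  simp only [Finset.sum_add_distrib, Finset.sum_sub_distrib]
  rw [hcomm2, hcomm2, hcomm1]
  ring

/-- The one-form `r` is closed, as the difference of the logarithmic derivative of the density and
`df`; antisymmetry then does the rest. -/
theorem dv_drift_sub_divTranspose {f : E → ℝ} (hf : ContDiffOn ℝ ∞ f U) {Y : E → E}
    (hY : ContDiffOn ℝ ∞ Y U) {y : E} (hy : y ∈ U) :
    dv g f (fun z => drift g f Y z - divTranspose g f Y z) y = 0 := by
  have hN := hg.contDiffOn_nab hY
  have hS := hg.contDiffOn_sharp
  have hG := hg.contDiffOn_christoffel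
  have hF := hg.contDiffOn_fderiv hf
  have hT : ∀ a c, ContDiffOn ℝ ∞ (fun z => cov c (nab g Y z (sharp g z (cov a)))
      - cov a (nab g Y z (sharp g z (cov c)))) U := fun a c => by fun_prop
  have hZ := (hg.contDiffOn_drift hf hY).sub (hg.contDiffOn_divTranspose hf hY)
  have key := sum_fderiv_add_mul_eq_zero vec hg.isOpen hT
    (fun a c z _ => (neg_sub _ _).symm)
    (r := fun a z => tr (christoffel g z (vec a)) - fderiv ℝ f z (vec a))
    (fun a => by fun_prop) ?_ (fun c z hz => hg.cov_drift_sub_divTranspose (f := f) hY hz c) hy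
  · rw [← key]
    have hZd := hg.differentiableAt hZ hy
    have h1 : ∀ c, fderiv ℝ (fun z => cov c (drift g f Y z - divTranspose g f Y z)) y (vec c) =
        cov c (fderiv ℝ (fun z => drift g f Y z - divTranspose g f Y z) y (vec c)) := fun c =>
      congr($(((cov c).hasFDerivAt.comp y hZd.hasFDerivAt).fderiv) (vec c))
    have h2 : ∀ (l : E →L[ℝ] ℝ) (v : E), l v = ∑ c, l (vec c) * cov c v := fun l v => by
      conv_lhs => rw [← sum_apply_vec_smul_cov l]
      simp
    simp only [dv]
    rw [tr_eq_sum, h2 (fderiv ℝ f y)]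
    simp only [h1, nab_apply, map_add, Finset.sum_add_distrib, sub_mul, Finset.sum_sub_distrib]
    have h3 := h2 (tr ∘L christoffel g y) (drift g f Y y - divTranspose g f Y y)
    simp only [ContinuousLinearMap.comp_apply] at h3
    rw [← h3, tr_eq_sum]
    simp only [hg.christoffel_symm hy (vec _)]
    ring
  · intro a c z hz
    have h1 := hg.differentiableAt hG hz
    have h2 := hg.differentiableAt hF hz
    rw [fderiv_fun_sub (by fun_prop) (by fun_prop), fderiv_fun_sub (by fun_prop) (by fun_prop),
      fderiv_clm_apply h2 (by fun_prop), fderiv_clm_apply h2 (by fun_prop)]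
    simp [hg.fderiv_tr_christoffel_symm hz (vec c), hg.fderiv_fderiv_symm hf hz (vec c)]

end IsMetricOn

/-! ### The commutation identities in coordinates. -/

namespace IsMetricOn

variable {g : E → E →L[ℝ] E →L[ℝ] ℝ} {U : Set E} (hg : IsMetricOn g U)
include hg

theorem drift_congr {f : E → ℝ} {Y Z : E → E} (h : ∀ y ∈ U, Y y = Z y) {y : E} (hy : y ∈ U) :
    drift g f Y y = drift g f Z y := by
  rw [drift, drift, hg.hessian_congr h hy, hg.nab_congr h hy]

theorem dv_congr {f : E → ℝ} {Y Z : E → E} (h : ∀ y ∈ U, Y y = Z y) {y : E} (hy : y ∈ U) :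
    dv g f Y y = dv g f Z y := by
  rw [dv, dv, hg.nab_congr h hy, h y hy]

theorem op_congr {f : E → ℝ} {Y Z : E → E} (h : ∀ y ∈ U, Y y = Z y) {y : E} (hy : y ∈ U) :
    op g f Y y = op g f Z y := by
  rw [op, op, hg.drift_congr h hy, divTranspose, divTranspose, hg.hessian_congr h hy,
    hg.nab_congr h hy]

theorem hessian_add_smul {Y Z : E → E} (hY : ContDiffOn ℝ ∞ Y U) (hZ : ContDiffOn ℝ ∞ Z U)
    (c : ℝ) {y : E} (hy : y ∈ U) :
    hessian g (fun z => Y z + c • Z z) y = hessian g Y y + c • hessian g Z y := by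
  have h1 := hg.differentiableAt (hg.contDiffOn_nab hY) hy
  have h2 := hg.differentiableAt (hg.contDiffOn_nab hZ) hy
  ext v w
  simp only [hessian_apply, add_apply, smul_apply, hg.nab_add_smul hY hZ c hy, map_add, map_smul,
    hg.fderiv_congr (fun z hz => hg.nab_add_smul hY hZ c hz) hy,
    fderiv_fun_add h1 (h2.fun_const_smul c), fderiv_fun_const_smul h2, smul_sub, smul_add]
  abel

theorem drift_add_smul {f : E → ℝ} {Y Z : E → E} (hY : ContDiffOn ℝ ∞ Y U)
    (hZ : ContDiffOn ℝ ∞ Z U) (c : ℝ) {y : E} (hy : y ∈ U) :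
    drift g f (fun z => Y z + c • Z z) y = drift g f Y y + c • drift g f Z y := by
  simp only [drift, hg.hessian_add_smul hY hZ c hy, hg.nab_add_smul hY hZ c hy, add_apply,
    smul_apply, Finset.sum_add_distrib, ← Finset.smul_sum, smul_sub]
  abel

theorem dv_add_smul {f : E → ℝ} {Y Z : E → E} (hY : ContDiffOn ℝ ∞ Y U)
    (hZ : ContDiffOn ℝ ∞ Z U) (c : ℝ) {y : E} (hy : y ∈ U) :
    dv g f (fun z => Y z + c • Z z) y = dv g f Y y + c * dv g f Z y := by
  simp only [dv, hg.nab_add_smul hY hZ c hy, map_add, map_smul, smul_eq_mul]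
  ring

theorem contDiffOn_op {f : E → ℝ} (hf : ContDiffOn ℝ ∞ f U) {Y : E → E}
    (hY : ContDiffOn ℝ ∞ Y U) : ContDiffOn ℝ ∞ (op g f Y) U :=
  contDiffOn_const.smul ((hg.contDiffOn_drift hf hY).add (hg.contDiffOn_divTranspose hf hY))

variable {f : E → ℝ} (hf : ContDiffOn ℝ ∞ f U) {κ : ℝ}
  (hsol : ∀ y ∈ U, ∀ v w, ric g y v w + g y (nab g (gr g f) y v) w = κ * g y v w)
  {Y : E → E} (hY : ContDiffOn ℝ ∞ Y U)
include hf hY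

theorem dv_drift {y : E} (hy : y ∈ U) : dv g f (drift g f Y) y = dv g f (divTranspose g f Y) y := by
  have h := hg.dv_drift_sub_divTranspose hf hY hy
  have h' := hg.dv_add_smul (f := f) (hg.contDiffOn_drift hf hY)
    (hg.contDiffOn_divTranspose hf hY) (-1) hy
  simp only [neg_smul, one_smul, ← sub_eq_add_neg] at h'
  linarith

include hsol

theorem drift_gr_dv {y : E} (hy : y ∈ U) :
    drift g f (gr g (dv g f Y)) y = gr g (dv g f (drift g f Y)) y := by
  have hu := hg.contDiffOn_dv hf hY
  have hu' := hg.contDiffOn_gr hu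
  rw [hg.drift_gr_eq_divTranspose hu hy, hg.divTranspose_eq hf hsol hu' hy,
    ← hg.gr_add_mul (hg.contDiffOn_dv hf hu') hu κ hy]
  refine hg.gr_congr (fun z hz => ?_) hy
  rw [hg.dv_drift hf hY hz, hg.dv_congr (fun w hw => hg.divTranspose_eq hf hsol hY hw) hz,
    hg.dv_add_smul hu' hY κ hz]

/-- On a gradient Ricci soliton the drift Laplacian commutes with `div_f div_f^*`. -/
theorem drift_op {y : E} (hy : y ∈ U) :
    drift g f (op g f Y) y = op g f (drift g f Y) y := by
  have hu := hg.contDiffOn_gr (hg.contDiffOn_dv hf hY)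
  have hD := hg.contDiffOn_drift hf hY
  -- The terms `0 + _` and `(1 : ℝ) • _` fit `drift_add_smul`, which thus serves for both sums and
  -- multiples.
  have h1 : ∀ z ∈ U, op g f Y z = 0 + (-1 / 2 : ℝ) • ((drift g f Y z + (1 : ℝ) •
      gr g (dv g f Y) z) + κ • Y z) := fun z hz => by
    rw [op, hg.divTranspose_eq hf hsol hY hz, one_smul, zero_add, add_assoc]
  rw [hg.drift_congr h1 hy, hg.drift_add_smul contDiffOn_const (by fun_prop) _ hy,
    hg.drift_add_smul (by fun_prop) hY κ hy, hg.drift_add_smul hD hu _ hy, op,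
    hg.divTranspose_eq hf hsol hD hy, hg.drift_gr_dv hf hsol hY hy]
  -- Linearity applied to `0 + (-1) • 0` yields the value at zero.
  have h0 : drift g f (fun _ => (0 : E)) y = 0 := by
    simpa using hg.drift_add_smul (f := f) (contDiffOn_const (c := (0 : E)))
      (contDiffOn_const (c := (0 : E))) (-1) hy
  rw [h0, one_smul, zero_add, add_assoc]

/-- On a gradient Ricci soliton `∇ div_f` commutes with `div_f div_f^*`. -/
theorem op_gr_dv {y : E} (hy : y ∈ U) :
    op g f (gr g (dv g f Y)) y = gr g (dv g f (op g f Y)) y := by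
  have hu := hg.contDiffOn_dv hf hY
  have hD := hg.contDiffOn_drift hf hY
  have hT := hg.contDiffOn_divTranspose hf hY
  have h1 : ∀ z ∈ U, dv g f (op g f Y) z = 0 + (-1) * dv g f (drift g f Y) z := fun z hz => by
    have h2 : ∀ w ∈ U, op g f Y w = (0 : E) + (-1 / 2 : ℝ) • (drift g f Y w + (1 : ℝ) •
      divTranspose g f Y w) := fun w _ => by rw [op, one_smul, zero_add]
    have h0 : dv g f (fun _ => (0 : E)) z = 0 := by
      simpa using hg.dv_add_smul (f := f) (contDiffOn_const (c := (0 : E)))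
        (contDiffOn_const (c := (0 : E))) (-1) hz
    rw [hg.dv_congr h2 hz, hg.dv_add_smul contDiffOn_const (by fun_prop) _ hz,
      hg.dv_add_smul hD hT _ hz, ← hg.dv_drift hf hY hz, h0]
    ring
  have h0 : gr g (fun _ => (0 : ℝ)) y = 0 := by simp [gr]
  rw [hg.gr_congr h1 hy, hg.gr_add_mul contDiffOn_const (hg.contDiffOn_dv hf hD) _ hy, op,
    ← hg.drift_gr_eq_divTranspose hu hy, hg.drift_gr_dv hf hsol hY hy, h0]
  module

end IsMetricOn

end LocalMetric

/-! ### Vector fields and brackets in a chart. -/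

namespace RicciSoliton

section Chart

variable {n : ℕ} {M : Type*} [TopologicalSpace M] [ChartedSpace (EuclideanSpace ℝ (Fin n)) M]

section

variable {x₀ x : M} (hx : x ∈ (extChartAt (𝓡 n) x₀).source)
include hx

theorem chart_mem_target : extChartAt (𝓡 n) x₀ x ∈ (extChartAt (𝓡 n) x₀).target :=
  (extChartAt (𝓡 n) x₀).map_source hx

theorem source_mem_nhds : (extChartAt (𝓡 n) x₀).source ∈ nhds x :=
  (isOpen_extChartAt_source x₀).mem_nhds hx

theorem target_mem_nhds : (extChartAt (𝓡 n) x₀).target ∈ nhds (extChartAt (𝓡 n) x₀ x) :=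
  (isOpen_extChartAt_target x₀).mem_nhds (chart_mem_target hx)

end

variable [IsManifold (𝓡 n) ∞ M]

/-- The coordinates of a tangent vector at `x` in the chart at `x₀`. -/
def coordAt (x₀ x : M) : TangentSpace (𝓡 n) x →L[ℝ] EuclideanSpace ℝ (Fin n) :=
  (trivializationAt (EuclideanSpace ℝ (Fin n)) (TangentSpace (𝓡 n) : M → Type _)
    x₀).continuousLinearMapAt ℝ x

/-- The tangent vector at `x` with given coordinates in the chart at `x₀`. -/
def coordSymm (x₀ x : M) : EuclideanSpace ℝ (Fin n) →L[ℝ] TangentSpace (𝓡 n) x :=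
  (trivializationAt (EuclideanSpace ℝ (Fin n)) (TangentSpace (𝓡 n) : M → Type _) x₀).symmL ℝ x

/-- The coordinate representation of a vector field in the chart at `x₀`. -/
def localField (x₀ : M) (Y : Π x : M, TangentSpace (𝓡 n) x) (y : EuclideanSpace ℝ (Fin n)) :
    EuclideanSpace ℝ (Fin n) :=
  coordAt x₀ ((extChartAt (𝓡 n) x₀).symm y) (Y ((extChartAt (𝓡 n) x₀).symm y))

variable {x₀ x : M} (hx : x ∈ (extChartAt (𝓡 n) x₀).source)

include hx in
theorem mem_baseSet :
    x ∈ (trivializationAt (EuclideanSpace ℝ (Fin n)) (TangentSpace (𝓡 n) : M → Type _)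
      x₀).baseSet := by
  simpa using hx

include hx

theorem coordAt_coordSymm (v : EuclideanSpace ℝ (Fin n)) :
    coordAt x₀ x (coordSymm x₀ x v) = v :=
  Trivialization.continuousLinearMapAt_symmL _ (mem_baseSet hx) v

theorem coordSymm_coordAt (v : TangentSpace (𝓡 n) x) : coordSymm x₀ x (coordAt x₀ x v) = v :=
  Trivialization.symmL_continuousLinearMapAt _ (mem_baseSet hx) v

theorem coordAt_injective : Function.Injective (coordAt (n := n) x₀ x) :=
  fun v w h => by rw [← coordSymm_coordAt hx v, h, coordSymm_coordAt hx]

theorem coordAt_eq_mfderiv :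
    coordAt x₀ x = mfderiv (𝓡 n) 𝓘(ℝ, EuclideanSpace ℝ (Fin n)) (extChartAt (𝓡 n) x₀) x :=
  TangentBundle.continuousLinearMapAt_trivializationAt (by simpa using hx)

theorem coordSymm_eq_mfderiv :
    coordSymm x₀ x = mfderiv 𝓘(ℝ, EuclideanSpace ℝ (Fin n)) (𝓡 n) (extChartAt (𝓡 n) x₀).symm
      (extChartAt (𝓡 n) x₀ x) := by
  have h := TangentBundle.symmL_trivializationAt (I := 𝓡 n) (x₀ := x₀) (x := x) (by simpa using hx)
  rw [modelWithCornersSelf_coe, Set.range_id, mfderivWithin_univ] at h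
  exact h

theorem localField_apply (Y : Π x : M, TangentSpace (𝓡 n) x) :
    localField x₀ Y (extChartAt (𝓡 n) x₀ x) = coordAt x₀ x (Y x) :=
  congrArg (fun z => coordAt x₀ z (Y z)) ((extChartAt (𝓡 n) x₀).left_inv hx)

theorem contMDiffAt_chart : ContMDiffAt (𝓡 n) 𝓘(ℝ, EuclideanSpace ℝ (Fin n)) ∞
    (extChartAt (𝓡 n) x₀) x :=
  contMDiffAt_extChartAt' (by simpa using hx)

theorem contMDiffAt_chart_symm : ContMDiffAt 𝓘(ℝ, EuclideanSpace ℝ (Fin n)) (𝓡 n) ∞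
    (extChartAt (𝓡 n) x₀).symm (extChartAt (𝓡 n) x₀ x) :=
  (contMDiffOn_extChartAt_symm x₀).contMDiffAt (target_mem_nhds hx)

theorem contDiffAt_comp_chart_symm {F : Type*} [NormedAddCommGroup F] [NormedSpace ℝ F]
    {u : M → F} (hu : ContMDiffAt (𝓡 n) 𝓘(ℝ, F) ∞ u x) :
    ContDiffAt ℝ ∞ (u ∘ (extChartAt (𝓡 n) x₀).symm) (extChartAt (𝓡 n) x₀ x) := by
  rw [← contMDiffAt_iff_contDiffAt]
  refine ContMDiffAt.comp_of_eq hu (contMDiffAt_chart_symm hx) ?_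
  exact (extChartAt (𝓡 n) x₀).left_inv hx

theorem contDiffAt_localField {Y : Π x : M, TangentSpace (𝓡 n) x}
    (hY : ContMDiffAt (𝓡 n) (𝓡 n).tangent ∞ (fun x => (⟨x, Y x⟩ : TangentBundle (𝓡 n) M)) x) :
    ContDiffAt ℝ ∞ (localField x₀ Y) (extChartAt (𝓡 n) x₀ x) := by
  have h := (Trivialization.contMDiffAt_section_iff
    (trivializationAt (EuclideanSpace ℝ (Fin n)) (TangentSpace (𝓡 n) : M → Type _) x₀)
    (mem_baseSet hx)).1 hY
  refine contDiffAt_comp_chart_symm hx (u := fun z => coordAt x₀ z (Y z)) ?_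
  refine h.congr_of_eventuallyEq ?_
  filter_upwards [source_mem_nhds hx] with z hz
  rw [coordAt, Trivialization.continuousLinearMapAt_apply,
    Trivialization.coe_linearMapAt_of_mem _ (mem_baseSet hz)]

omit hx in
theorem contDiffOn_comp_chart_symm {f : M → ℝ} (hf : ContMDiff (𝓡 n) 𝓘(ℝ) ∞ f) :
    ContDiffOn ℝ ∞ (f ∘ (extChartAt (𝓡 n) x₀).symm) (extChartAt (𝓡 n) x₀).target := by
  intro y hy
  have h := contDiffAt_comp_chart_symm ((extChartAt (𝓡 n) x₀).map_target hy) (hf _)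
  rw [(extChartAt (𝓡 n) x₀).right_inv hy] at h
  exact h.contDiffWithinAt

omit hx in
theorem contDiffOn_localField {Y : Π x : M, TangentSpace (𝓡 n) x}
    (hY : ContMDiff (𝓡 n) (𝓡 n).tangent ∞ (fun x => (⟨x, Y x⟩ : TangentBundle (𝓡 n) M))) :
    ContDiffOn ℝ ∞ (localField x₀ Y) (extChartAt (𝓡 n) x₀).target := by
  intro y hy
  have h := contDiffAt_localField ((extChartAt (𝓡 n) x₀).map_target hy) (hY _)
  rw [(extChartAt (𝓡 n) x₀).right_inv hy] at h
  exact h.contDiffWithinAt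

theorem mdifferentiableAt_of_localField {Y : Π x : M, TangentSpace (𝓡 n) x}
    (hY : DifferentiableAt ℝ (localField x₀ Y) (extChartAt (𝓡 n) x₀ x)) :
    MDifferentiableAt (𝓡 n) (𝓡 n).tangent (fun x => (⟨x, Y x⟩ : TangentBundle (𝓡 n) M)) x := by
  refine (Trivialization.mdifferentiableAt_section_iff (𝓡 n)
    (trivializationAt (EuclideanSpace ℝ (Fin n)) (TangentSpace (𝓡 n) : M → Type _) x₀) Y
    (mem_baseSet hx)).2 ?_
  have h : MDifferentiableAt (𝓡 n) 𝓘(ℝ, EuclideanSpace ℝ (Fin n))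
      (localField x₀ Y ∘ extChartAt (𝓡 n) x₀) x :=
    hY.comp_mdifferentiableAt ((contMDiffAt_chart hx).mdifferentiableAt (by simp))
  refine h.congr_of_eventuallyEq ?_
  filter_upwards [source_mem_nhds hx] with z hz
  rw [Function.comp_apply, localField_apply hz, coordAt,
    Trivialization.continuousLinearMapAt_apply,
    Trivialization.coe_linearMapAt_of_mem _ (mem_baseSet hz)]

theorem mvfderiv_eq_fderiv {u : M → ℝ}
    (hu : DifferentiableAt ℝ (u ∘ (extChartAt (𝓡 n) x₀).symm) (extChartAt (𝓡 n) x₀ x))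
    (v : TangentSpace (𝓡 n) x) :
    mvfderiv (𝓡 n) u x v =
      fderiv ℝ (u ∘ (extChartAt (𝓡 n) x₀).symm) (extChartAt (𝓡 n) x₀ x) (coordAt x₀ x v) := by
  have h : u =ᶠ[nhds x] (u ∘ (extChartAt (𝓡 n) x₀).symm) ∘ extChartAt (𝓡 n) x₀ := by
    filter_upwards [source_mem_nhds hx] with z hz
    simp only [Function.comp_apply, (extChartAt (𝓡 n) x₀).left_inv hz]
  have h1 : mvfderiv (𝓡 n) u x =
      mvfderiv (𝓡 n) ((u ∘ (extChartAt (𝓡 n) x₀).symm) ∘ extChartAt (𝓡 n) x₀) x := by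
    simp only [mvfderiv, h.mfderiv_eq]
    rfl
  rw [h1, mvfderiv_comp_apply x hu.mdifferentiableAt
    ((contMDiffAt_chart hx).mdifferentiableAt (by simp)), coordAt_eq_mfderiv hx]
  simp only [mvfderiv, mfderiv_eq_fderiv]
  rfl

/-- Brackets are natural under pullback by the inverse chart, and that pullback of a field is its
coordinate representation. -/
theorem coordAt_mlieBracket {Y Z : Π x : M, TangentSpace (𝓡 n) x}
    (hY : DifferentiableAt ℝ (localField x₀ Y) (extChartAt (𝓡 n) x₀ x))
    (hZ : DifferentiableAt ℝ (localField x₀ Z) (extChartAt (𝓡 n) x₀ x)) :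
    coordAt x₀ x (VectorField.mlieBracket (𝓡 n) Y Z x) =
      fderiv ℝ (localField x₀ Z) (extChartAt (𝓡 n) x₀ x) (coordAt x₀ x (Y x))
      - fderiv ℝ (localField x₀ Y) (extChartAt (𝓡 n) x₀ x) (coordAt x₀ x (Z x)) := by
  have hpull : ∀ W : Π x : M, TangentSpace (𝓡 n) x, ∀ z ∈ (extChartAt (𝓡 n) x₀).target,
      VectorField.mpullback 𝓘(ℝ, EuclideanSpace ℝ (Fin n)) (𝓡 n) (extChartAt (𝓡 n) x₀).symm W z
        = localField x₀ W z := by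
    intro W z hz
    have h := coordSymm_eq_mfderiv ((extChartAt (𝓡 n) x₀).map_target hz)
    rw [(extChartAt (𝓡 n) x₀).right_inv hz] at h
    rw [VectorField.mpullback_apply, ← h]
    have hz' := (extChartAt (𝓡 n) x₀).map_target hz
    have hinv : (coordSymm (n := n) x₀ ((extChartAt (𝓡 n) x₀).symm z)).inverse =
        coordAt x₀ ((extChartAt (𝓡 n) x₀).symm z) :=
      ContinuousLinearMap.inverse_eq (ContinuousLinearMap.ext (coordSymm_coordAt hz'))
        (ContinuousLinearMap.ext (coordAt_coordSymm hz'))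
    exact congr($hinv (W ((extChartAt (𝓡 n) x₀).symm z)))
  have : IsManifold (𝓡 n) (minSmoothness ℝ 2) M := by
    rw [minSmoothness_of_isRCLikeNormedField]; infer_instance
  have hxx := (extChartAt (𝓡 n) x₀).left_inv hx
  have h := VectorField.mpullback_mlieBracket (n := ∞) (V := Y) (W := Z)
    (x₀ := extChartAt (𝓡 n) x₀ x) (f := (extChartAt (𝓡 n) x₀).symm)
    (I := 𝓘(ℝ, EuclideanSpace ℝ (Fin n))) (I' := 𝓡 n)
    (hxx.symm ▸ mdifferentiableAt_of_localField hx hY)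
    (hxx.symm ▸ mdifferentiableAt_of_localField hx hZ)
    (contMDiffAt_chart_symm hx)
    (by rw [minSmoothness_of_isRCLikeNormedField]; norm_cast)
  rw [hpull _ _ (chart_mem_target hx), localField_apply hx] at h
  have hflat : ∀ V W : EuclideanSpace ℝ (Fin n) → EuclideanSpace ℝ (Fin n),
      VectorField.mlieBracket 𝓘(ℝ, EuclideanSpace ℝ (Fin n)) V W =
        VectorField.lieBracket ℝ V W := fun V W =>
    VectorField.mlieBracketWithin_univ.symm.trans
      (VectorField.mlieBracketWithin_eq_lieBracketWithin.trans VectorField.lieBracketWithin_univ)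
  refine h.trans ((congrFun (hflat _ _) _).trans ?_)
  refine (Filter.EventuallyEq.lieBracket_vectorField_eq
    (Filter.eventually_of_mem (target_mem_nhds hx) (hpull Y))
    (Filter.eventually_of_mem (target_mem_nhds hx) (hpull Z))).trans ?_
  rw [VectorField.lieBracket, localField_apply hx, localField_apply hx]

theorem contMDiffAt_coordSymm (v : EuclideanSpace ℝ (Fin n)) :
    ContMDiffAt (𝓡 n) (𝓡 n).tangent ∞
      (fun z => (⟨z, coordSymm x₀ z v⟩ : TangentBundle (𝓡 n) M)) x := by
  refine (Trivialization.contMDiffAt_section_iff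
    (trivializationAt (EuclideanSpace ℝ (Fin n)) (TangentSpace (𝓡 n) : M → Type _) x₀)
    (mem_baseSet hx)).2 ?_
  refine (contMDiffAt_const (c := v)).congr_of_eventuallyEq ?_
  filter_upwards [source_mem_nhds hx] with z hz
  have h := coordAt_coordSymm hz v
  rwa [coordAt, Trivialization.continuousLinearMapAt_apply,
    Trivialization.coe_linearMapAt_of_mem _ (mem_baseSet hz)] at h

/-- The extension `ext v` is guaranteed smooth only near `x`, so the operators below are compared on
an open `U` that may be smaller than the chart target. -/
theorem exists_contDiffOn_localField_ext (v : TangentSpace (𝓡 n) x) :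
    ∃ U : Set (EuclideanSpace ℝ (Fin n)), IsOpen U ∧ extChartAt (𝓡 n) x₀ x ∈ U ∧
      U ⊆ (extChartAt (𝓡 n) x₀).target ∧ ContDiffOn ℝ ∞ (localField x₀ (ext v)) U := by
  obtain ⟨s, hs, hv⟩ := FiberBundle.exists_contMDiffOn_extend (k := ∞) (𝓡 n)
    (EuclideanSpace ℝ (Fin n)) (V := (TangentSpace (𝓡 n) : M → Type _)) v
  have hmem : (extChartAt (𝓡 n) x₀).target ∩ (extChartAt (𝓡 n) x₀).symm ⁻¹' interior s ∈
      nhds (extChartAt (𝓡 n) x₀ x) := by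
    refine Filter.inter_mem (target_mem_nhds hx)
      ((continuousAt_extChartAt_symm' hx).preimage_mem_nhds ?_)
    rw [(extChartAt (𝓡 n) x₀).left_inv hx]
    exact isOpen_interior.mem_nhds (mem_interior_iff_mem_nhds.2 hs)
  refine ⟨interior ((extChartAt (𝓡 n) x₀).target ∩ (extChartAt (𝓡 n) x₀).symm ⁻¹' interior s),
    isOpen_interior, mem_interior_iff_mem_nhds.2 hmem,
    interior_subset.trans Set.inter_subset_left, fun y hy => ContDiffAt.contDiffWithinAt ?_⟩
  obtain ⟨hy1, hy2⟩ := interior_subset hy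
  have h := contDiffAt_localField ((extChartAt (𝓡 n) x₀).map_target hy1)
    (hv.contMDiffAt (mem_interior_iff_mem_nhds.1 hy2))
  rwa [(extChartAt (𝓡 n) x₀).right_inv hy1] at h

omit hx in
theorem ext_self (v : TangentSpace (𝓡 n) x) : ext v x = v := FiberBundle.extend_apply_self _ v

theorem differentiableAt_localField_ext (v : TangentSpace (𝓡 n) x) :
    DifferentiableAt ℝ (localField x₀ (ext v)) (extChartAt (𝓡 n) x₀ x) := by
  obtain ⟨_, h1, h2, _, h3⟩ := exists_contDiffOn_localField_ext hx v
  exact (h3.contDiffAt (h1.mem_nhds h2)).differentiableAt (by simp)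

end Chart

end RicciSoliton
-- The metric in a chart.
namespace RicciSoliton

open LocalMetric

section Metric

variable {n : ℕ} {M : Type*} [TopologicalSpace M] [ChartedSpace (EuclideanSpace ℝ (Fin n)) M]
  [IsManifold (𝓡 n) ∞ M] [RiemannianBundle (fun x : M => TangentSpace (𝓡 n) x)]

/-- The Riemannian metric in the chart at `x₀`. -/
def localMetric (x₀ : M) (y : EuclideanSpace ℝ (Fin n)) :
    EuclideanSpace ℝ (Fin n) →L[ℝ] EuclideanSpace ℝ (Fin n) →L[ℝ] ℝ :=
  (innerSL ℝ : TangentSpace (𝓡 n) ((extChartAt (𝓡 n) x₀).symm y) →L[ℝ]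
    TangentSpace (𝓡 n) ((extChartAt (𝓡 n) x₀).symm y) →L[ℝ] ℝ).bilinearComp
    (coordSymm x₀ ((extChartAt (𝓡 n) x₀).symm y)) (coordSymm x₀ ((extChartAt (𝓡 n) x₀).symm y))

theorem localMetric_apply (x₀ : M) (y v w : EuclideanSpace ℝ (Fin n)) :
    localMetric x₀ y v w = inner ℝ (coordSymm x₀ ((extChartAt (𝓡 n) x₀).symm y) v)
      (coordSymm x₀ ((extChartAt (𝓡 n) x₀).symm y) w) := rfl

theorem inner_eq_localMetric {x₀ x : M} (hx : x ∈ (extChartAt (𝓡 n) x₀).source)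
    (v w : TangentSpace (𝓡 n) x) :
    inner ℝ v w = localMetric x₀ (extChartAt (𝓡 n) x₀ x) (coordAt x₀ x v) (coordAt x₀ x w) := by
  rw [localMetric_apply]
  refine Eq.trans ?_ (congrArg (fun z => inner ℝ (coordSymm x₀ z (coordAt x₀ x v))
    (coordSymm x₀ z (coordAt x₀ x w))) ((extChartAt (𝓡 n) x₀).left_inv hx)).symm
  rw [coordSymm_coordAt hx, coordSymm_coordAt hx]

theorem inner_comp_chart_symm {x₀ x : M} (hx : x ∈ (extChartAt (𝓡 n) x₀).source)
    (Y Z : Π x : M, TangentSpace (𝓡 n) x) :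
    (fun z => inner ℝ (Y z) (Z z)) ∘ (extChartAt (𝓡 n) x₀).symm
      =ᶠ[nhds (extChartAt (𝓡 n) x₀ x)]
    fun y => localMetric x₀ y (localField x₀ Y y) (localField x₀ Z y) := by
  filter_upwards [target_mem_nhds hx] with y hy
  rw [Function.comp_apply, inner_eq_localMetric ((extChartAt (𝓡 n) x₀).map_target hy),
    (extChartAt (𝓡 n) x₀).right_inv hy]
  rfl

theorem divAdjoint_apply (Y : Π x : M, TangentSpace (𝓡 n) x) (x : M)
    (v w : TangentSpace (𝓡 n) x) : divAdjoint Y x v w =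
      (-1 / 2 : ℝ) * (inner ℝ (nabla Y x v) w + inner ℝ (nabla Y x w) v) := rfl

theorem isMetricOn_localMetric
    [IsContMDiffRiemannianBundle (𝓡 n) ∞ (EuclideanSpace ℝ (Fin n))
      (fun x : M => TangentSpace (𝓡 n) x)] (x₀ : M) :
    IsMetricOn (localMetric (n := n) x₀) (extChartAt (𝓡 n) x₀).target where
  isOpen := isOpen_extChartAt_target x₀
  smooth := by
    rw [contDiffOn_clm_apply]
    intro v
    rw [contDiffOn_clm_apply]
    intro w y hy
    have hx := (extChartAt (𝓡 n) x₀).map_target hy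
    have h := contDiffAt_comp_chart_symm hx (ContMDiffAt.inner_bundle
      (contMDiffAt_coordSymm hx v) (contMDiffAt_coordSymm hx w))
    rw [(extChartAt (𝓡 n) x₀).right_inv hy] at h
    exact h.contDiffWithinAt
  symm y _ v w := by rw [localMetric_apply, localMetric_apply, real_inner_comm]
  pos y hy v hv := by
    rw [localMetric_apply, real_inner_self_pos]
    intro h
    refine hv ?_
    rw [← coordAt_coordSymm ((extChartAt (𝓡 n) x₀).map_target hy) v, h, map_zero]

end Metric

end RicciSoliton
-- The Levi-Civita connection, frames and gradients in a chart.
namespace RicciSoliton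

open LocalMetric

section Connection

variable {n : ℕ} {M : Type*} [TopologicalSpace M] [ChartedSpace (EuclideanSpace ℝ (Fin n)) M]
  [IsManifold (𝓡 n) ∞ M] [RiemannianBundle (fun x : M => TangentSpace (𝓡 n) x)]
  [IsContMDiffRiemannianBundle (𝓡 n) ∞ (EuclideanSpace ℝ (Fin n))
    (fun x : M => TangentSpace (𝓡 n) x)]

variable {x₀ x : M} (hx : x ∈ (extChartAt (𝓡 n) x₀).source)
include hx

theorem mvfderiv_inner {Y Z : Π x : M, TangentSpace (𝓡 n) x}
    (hY : DifferentiableAt ℝ (localField x₀ Y) (extChartAt (𝓡 n) x₀ x))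
    (hZ : DifferentiableAt ℝ (localField x₀ Z) (extChartAt (𝓡 n) x₀ x))
    (v : TangentSpace (𝓡 n) x) :
    mvfderiv (𝓡 n) (fun z => inner ℝ (Y z) (Z z)) x v =
      fderiv ℝ (localMetric x₀) (extChartAt (𝓡 n) x₀ x) (coordAt x₀ x v) (coordAt x₀ x (Y x))
          (coordAt x₀ x (Z x))
        + localMetric x₀ (extChartAt (𝓡 n) x₀ x)
          (fderiv ℝ (localField x₀ Y) (extChartAt (𝓡 n) x₀ x) (coordAt x₀ x v)) (coordAt x₀ x (Z x))
        + localMetric x₀ (extChartAt (𝓡 n) x₀ x) (coordAt x₀ x (Y x))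
          (fderiv ℝ (localField x₀ Z) (extChartAt (𝓡 n) x₀ x) (coordAt x₀ x v)) := by
  have hg := isMetricOn_localMetric (n := n) x₀
  have hgd := hg.differentiableAt hg.smooth (chart_mem_target hx)
  have h := inner_comp_chart_symm hx Y Z
  have hd : DifferentiableAt ℝ (fun y => localMetric x₀ y (localField x₀ Y y) (localField x₀ Z y))
      (extChartAt (𝓡 n) x₀ x) := by fun_prop
  rw [mvfderiv_eq_fderiv hx (hd.congr_of_eventuallyEq h), h.fderiv_eq,
    fderiv_clm_apply (by fun_prop) hZ, fderiv_clm_apply hgd hY]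
  simp only [add_apply, ContinuousLinearMap.comp_apply, ContinuousLinearMap.flip_apply,
    localField_apply hx]
  ring

/-- The brackets cancel every derivative of `X` and `Z`, so the value depends on those fields only
at `x`. -/
theorem koszul_eq {X Y Z : Π x : M, TangentSpace (𝓡 n) x}
    (hX : DifferentiableAt ℝ (localField x₀ X) (extChartAt (𝓡 n) x₀ x))
    (hY : DifferentiableAt ℝ (localField x₀ Y) (extChartAt (𝓡 n) x₀ x))
    (hZ : DifferentiableAt ℝ (localField x₀ Z) (extChartAt (𝓡 n) x₀ x)) :
    koszul X Y Z x = 2 * localMetric x₀ (extChartAt (𝓡 n) x₀ x)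
      (nab (localMetric x₀) (localField x₀ Y) (extChartAt (𝓡 n) x₀ x) (coordAt x₀ x (X x)))
      (coordAt x₀ x (Z x)) := by
  have hg := isMetricOn_localMetric (n := n) x₀
  have hy := chart_mem_target hx
  rw [koszul, mvfderiv_inner hx hY hZ, mvfderiv_inner hx hZ hX, mvfderiv_inner hx hX hY,
    inner_eq_localMetric hx, inner_eq_localMetric hx, inner_eq_localMetric hx,
    coordAt_mlieBracket hx hX hY, coordAt_mlieBracket hx hX hZ, coordAt_mlieBracket hx hY hZ,
    nab_apply, map_add, add_apply, hg.apply_christoffel hy, christoffelFst_apply,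
    localField_apply hx]
  simp only [map_sub, sub_apply, hg.symm _ hy (coordAt x₀ x (X x)),
    hg.symm _ hy (coordAt x₀ x (Y x)) (fderiv ℝ _ _ _),
    hg.symm _ hy (coordAt x₀ x (Z x)) (fderiv ℝ _ _ _),
    hg.fderiv_symm hy _ (coordAt x₀ x (Z x)) (coordAt x₀ x (X x))]
  ring

/-- By `koszul_eq` the coefficients defining `nabla` are inner products with frame vectors, so the
expansion reassembles. The frame varies arbitrarily with the point; it disappears here before
anything is differentiated again. -/
theorem coordAt_nabla {Y : Π x : M, TangentSpace (𝓡 n) x}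
    (hY : DifferentiableAt ℝ (localField x₀ Y) (extChartAt (𝓡 n) x₀ x))
    (v : TangentSpace (𝓡 n) x) :
    coordAt x₀ x (nabla Y x v) =
      nab (localMetric x₀) (localField x₀ Y) (extChartAt (𝓡 n) x₀ x) (coordAt x₀ x v) := by
  have hg := isMetricOn_localMetric (n := n) x₀
  have hy := chart_mem_target hx
  have hext : ∀ w : TangentSpace (𝓡 n) x, ext w x = w := FiberBundle.extend_apply_self _
  have hk : ∀ i j, koszul (ext (frame x i)) Y (ext (frame x j)) x / 2 =
      inner ℝ (coordSymm x₀ x (nab (localMetric x₀) (localField x₀ Y) (extChartAt (𝓡 n) x₀ x)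
        (coordAt x₀ x (frame x i)))) (frame x j) := fun i j => by
    obtain ⟨_, h1, h2, _, h3⟩ := exists_contDiffOn_localField_ext hx (frame x i)
    obtain ⟨_, h4, h5, _, h6⟩ := exists_contDiffOn_localField_ext hx (frame x j)
    rw [koszul_eq hx ((h3.contDiffAt (h1.mem_nhds h2)).differentiableAt (by simp)) hY
      ((h6.contDiffAt (h4.mem_nhds h5)).differentiableAt (by simp)), hext, hext,
      inner_eq_localMetric hx (coordSymm _ _ _), coordAt_coordSymm hx]
    ring
  have h1 : ∀ i, ∑ j, (koszul (ext (frame x i)) Y (ext (frame x j)) x / 2) • frame x j =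
      coordSymm x₀ x (nab (localMetric x₀) (localField x₀ Y) (extChartAt (𝓡 n) x₀ x)
        (coordAt x₀ x (frame x i))) := fun i => by
    simp_rw [hk]
    simp_rw [real_inner_comm (frame x _)]
    exact (frame x).sum_repr' _
  have h2 : nabla Y x v = coordSymm x₀ x (nab (localMetric x₀) (localField x₀ Y)
      (extChartAt (𝓡 n) x₀ x) (coordAt x₀ x v)) := by
    have h3 : nabla Y x v = ∑ i, (inner ℝ (frame x i) v : ℝ) •
        ∑ j, (koszul (ext (frame x i)) Y (ext (frame x j)) x / 2) • frame x j := by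
      simp only [nabla, sum_apply, Finset.smul_sum]
      refine Finset.sum_congr rfl fun i _ => Finset.sum_congr rfl fun j _ => ?_
      simp [smul_smul, mul_comm]
    rw [h3]
    simp_rw [h1]
    conv_rhs => rw [← (frame x).sum_repr' v]
    simp only [map_sum, map_smul]
  rw [h2, coordAt_coordSymm hx]

theorem sharp_eq_sum_frame (l : EuclideanSpace ℝ (Fin n) →L[ℝ] ℝ) :
    sharp (localMetric x₀) (extChartAt (𝓡 n) x₀ x) l =
      ∑ i, l (coordAt x₀ x (frame x i)) • coordAt x₀ x (frame x i) := by
  have hg := isMetricOn_localMetric (n := n) x₀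
  have hy := chart_mem_target hx
  refine hg.ext_apply hy fun w => ?_
  rw [hg.apply_sharp hy, ← coordAt_coordSymm hx w]
  conv_lhs => rw [← (frame x).sum_repr' (coordSymm x₀ x w)]
  simp only [map_sum, map_smul, sum_apply, smul_apply, smul_eq_mul, ← inner_eq_localMetric hx]
  exact Finset.sum_congr rfl fun i _ => mul_comm _ _

/-- Both sides contract `B` with the inverse metric, so the frame trace does not depend on the
frame. -/
theorem sum_frame_eq {F : Type*} [AddCommGroup F] [Module ℝ F] [TopologicalSpace F]
    [IsTopologicalAddGroup F] [ContinuousSMul ℝ F]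
    (B : EuclideanSpace ℝ (Fin n) →L[ℝ] EuclideanSpace ℝ (Fin n) →L[ℝ] F) :
    ∑ i, B (coordAt x₀ x (frame x i)) (coordAt x₀ x (frame x i)) =
      ∑ a, B (vec a) (sharp (localMetric x₀) (extChartAt (𝓡 n) x₀ x) (cov a)) := by
  simp_rw [sharp_eq_sum_frame hx, map_sum, map_smul]
  rw [Finset.sum_comm]
  refine Finset.sum_congr rfl fun i _ => ?_
  have h := congrArg (fun v => B v (coordAt x₀ x (frame x i)))
    (sum_cov_smul_vec (coordAt x₀ x (frame x i)))
  simpa only [map_sum, map_smul, sum_apply, smul_apply] using h.symm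

theorem sum_localMetric_frame_eq
    (A : EuclideanSpace ℝ (Fin n) →L[ℝ] EuclideanSpace ℝ (Fin n)) :
    ∑ i, localMetric x₀ (extChartAt (𝓡 n) x₀ x) (A (coordAt x₀ x (frame x i)))
      (coordAt x₀ x (frame x i)) = tr A := by
  have hg := isMetricOn_localMetric (n := n) x₀
  refine (sum_frame_eq hx (localMetric x₀ (extChartAt (𝓡 n) x₀ x) ∘L A)).trans ?_
  simp only [ContinuousLinearMap.comp_apply, hg.apply_sharp' (chart_mem_target hx), tr_eq_sum]

theorem coordAt_grad {u : M → ℝ}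
    (hu : DifferentiableAt ℝ (u ∘ (extChartAt (𝓡 n) x₀).symm) (extChartAt (𝓡 n) x₀ x)) :
    coordAt x₀ x (grad u x) =
      gr (localMetric x₀) (u ∘ (extChartAt (𝓡 n) x₀).symm) (extChartAt (𝓡 n) x₀ x) := by
  rw [gr, sharp_eq_sum_frame hx, grad]
  simp only [map_sum, map_smul, mvfderiv_eq_fderiv hx hu]

end Connection

-- Curvature and the weighted operators in a chart.

end RicciSoliton
namespace RicciSoliton

open LocalMetric

section Operators

variable {n : ℕ} {M : Type*} [TopologicalSpace M] [ChartedSpace (EuclideanSpace ℝ (Fin n)) M]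
  [IsManifold (𝓡 n) ∞ M] [RiemannianBundle (fun x : M => TangentSpace (𝓡 n) x)]
  [IsContMDiffRiemannianBundle (𝓡 n) ∞ (EuclideanSpace ℝ (Fin n))
    (fun x : M => TangentSpace (𝓡 n) x)]

variable {x₀ x : M} (hx : x ∈ (extChartAt (𝓡 n) x₀).source)
include hx

variable {U : Set (EuclideanSpace ℝ (Fin n))} (hU : IsOpen U)
  (hUt : U ⊆ (extChartAt (𝓡 n) x₀).target) (hxU : extChartAt (𝓡 n) x₀ x ∈ U)

omit hx in
include hU hUt in
theorem localField_nabla {Y : Π x : M, TangentSpace (𝓡 n) x}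
    (hY : ContDiffOn ℝ ∞ (localField x₀ Y) U) (W : Π x : M, TangentSpace (𝓡 n) x) :
    ∀ y ∈ U, localField x₀ (fun z => nabla Y z (W z)) y =
      nab (localMetric x₀) (localField x₀ Y) y (localField x₀ W y) := by
  intro y hy
  have hd := ((hY.contDiffAt (hU.mem_nhds hy)).differentiableAt (by simp))
  have h := (extChartAt (𝓡 n) x₀).right_inv (hUt hy)
  rw [← h] at hd
  have h1 := coordAt_nabla ((extChartAt (𝓡 n) x₀).map_target (hUt hy)) hd
    (W ((extChartAt (𝓡 n) x₀).symm y))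
  rw [h] at h1
  exact h1

include hU hUt hxU

theorem coordAt_nabla_nabla {Y W : Π x : M, TangentSpace (𝓡 n) x}
    (hY : ContDiffOn ℝ ∞ (localField x₀ Y) U)
    (hW : DifferentiableAt ℝ (localField x₀ W) (extChartAt (𝓡 n) x₀ x))
    (v : TangentSpace (𝓡 n) x) :
    coordAt x₀ x (nabla (fun z => nabla Y z (W z)) x v) =
      hessian (localMetric x₀) (localField x₀ Y) (extChartAt (𝓡 n) x₀ x) (coordAt x₀ x v)
          (coordAt x₀ x (W x))
        + nab (localMetric x₀) (localField x₀ Y) (extChartAt (𝓡 n) x₀ x)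
          (nab (localMetric x₀) (localField x₀ W) (extChartAt (𝓡 n) x₀ x) (coordAt x₀ x v)) := by
  have hg := (isMetricOn_localMetric (n := n) x₀).mono hU hUt
  have h := Filter.eventually_of_mem (hU.mem_nhds hxU) (localField_nabla hU hUt hY W)
  have hd := hg.differentiableAt (hg.contDiffOn_nab hY) hxU
  rw [coordAt_nabla hx ((hd.clm_apply hW).congr_of_eventuallyEq h), nab_apply,
    Filter.EventuallyEq.fderiv_eq h, fderiv_clm_apply hd hW, hessian_apply,
    localField_nabla hU hUt hY W _ hxU]
  simp only [localField_apply hx, add_apply,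
    ContinuousLinearMap.comp_apply, ContinuousLinearMap.flip_apply, nab_apply, map_add]
  abel

/-- The subtracted term cancels exactly the derivative of the chosen extension. -/
theorem coordAt_nabla₂ {Y : Π x : M, TangentSpace (𝓡 n) x}
    (hY : ContDiffOn ℝ ∞ (localField x₀ Y) U) (v w : TangentSpace (𝓡 n) x) :
    coordAt x₀ x (nabla₂ Y x v w) = hessian (localMetric x₀) (localField x₀ Y)
      (extChartAt (𝓡 n) x₀ x) (coordAt x₀ x v) (coordAt x₀ x w) := by
  have hg := (isMetricOn_localMetric (n := n) x₀).mono hU hUt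
  rw [nabla₂, map_sub, coordAt_nabla_nabla hx hU hUt hxU hY (differentiableAt_localField_ext hx w),
    coordAt_nabla hx (hg.differentiableAt hY hxU),
    coordAt_nabla hx (differentiableAt_localField_ext hx w), ext_self]
  abel

omit hU hUt hxU in
-- The derivatives of the extensions of `u` and `v` cancel against the bracket term because the
-- connection is torsion-free; the Ricci identity leaves the coordinate curvature.
theorem coordAt_curvature (u v w : TangentSpace (𝓡 n) x) :
    coordAt x₀ x (curvature x u v w) = curv (localMetric x₀) (extChartAt (𝓡 n) x₀ x)
      (coordAt x₀ x u) (coordAt x₀ x v) (coordAt x₀ x w) := by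
  obtain ⟨U, hU, hxU, hUt, hw⟩ := exists_contDiffOn_localField_ext hx w
  have hg := (isMetricOn_localMetric (n := n) x₀).mono hU hUt
  rw [curvature, map_sub, map_sub,
    coordAt_nabla_nabla hx hU hUt hxU hw (differentiableAt_localField_ext hx v),
    coordAt_nabla_nabla hx hU hUt hxU hw (differentiableAt_localField_ext hx u),
    coordAt_nabla hx (hg.differentiableAt hw hxU),
    coordAt_mlieBracket hx (differentiableAt_localField_ext hx u)
      (differentiableAt_localField_ext hx v), ext_self, ext_self]
  have h := hg.hessian_sub_hessian hw hxU (coordAt x₀ x u) (coordAt x₀ x v)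
  rw [localField_apply hx, ext_self] at h
  rw [← h, nab_apply _ (localField x₀ (ext v)), nab_apply _ (localField x₀ (ext u)),
    localField_apply hx, localField_apply hx, ext_self, ext_self,
    hg.christoffel_symm hxU (coordAt x₀ x v) (coordAt x₀ x u)]
  simp only [map_add, map_sub]
  abel

omit hU hUt hxU in
theorem ricci_eq (v w : TangentSpace (𝓡 n) x) :
    ricci x v w = ric (localMetric x₀) (extChartAt (𝓡 n) x₀ x) (coordAt x₀ x v)
      (coordAt x₀ x w) := by
  let A : EuclideanSpace ℝ (Fin n) →L[ℝ] EuclideanSpace ℝ (Fin n) :=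
    LinearMap.toContinuousLinearMap
      { toFun := fun u => curv (localMetric x₀) (extChartAt (𝓡 n) x₀ x) u (coordAt x₀ x v)
          (coordAt x₀ x w)
        map_add' := fun a b => curv_add_left ..
        map_smul' := fun c a => curv_smul_left .. }
  have h := sum_localMetric_frame_eq hx A
  rw [tr_eq_sum] at h
  simp only [ricci, inner_eq_localMetric hx, coordAt_curvature hx]
  exact h

theorem coordAt_driftLaplacian {f : M → ℝ}
    (hf : ContDiffOn ℝ ∞ (f ∘ (extChartAt (𝓡 n) x₀).symm) U)
    {Y : Π x : M, TangentSpace (𝓡 n) x} (hY : ContDiffOn ℝ ∞ (localField x₀ Y) U) :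
    coordAt x₀ x (driftLaplacian f Y x) = drift (localMetric x₀)
      (f ∘ (extChartAt (𝓡 n) x₀).symm) (localField x₀ Y) (extChartAt (𝓡 n) x₀ x) := by
  have hg := (isMetricOn_localMetric (n := n) x₀).mono hU hUt
  rw [driftLaplacian, map_sub, coordAt_nabla hx (hg.differentiableAt hY hxU),
    coordAt_grad hx (hg.differentiableAt hf hxU), map_sum, drift]
  simp only [coordAt_nabla₂ hx hU hUt hxU hY]
  rw [sum_frame_eq hx]

theorem divf_eq {f : M → ℝ} (hf : ContDiffOn ℝ ∞ (f ∘ (extChartAt (𝓡 n) x₀).symm) U)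
    {Y : Π x : M, TangentSpace (𝓡 n) x} (hY : ContDiffOn ℝ ∞ (localField x₀ Y) U) :
    divf f Y x = dv (localMetric x₀)
      (f ∘ (extChartAt (𝓡 n) x₀).symm) (localField x₀ Y) (extChartAt (𝓡 n) x₀ x) := by
  have hg := (isMetricOn_localMetric (n := n) x₀).mono hU hUt
  simp only [divf, inner_eq_localMetric hx, coordAt_nabla hx (hg.differentiableAt hY hxU),
    coordAt_grad hx (hg.differentiableAt hf hxU), sum_localMetric_frame_eq hx]
  rw [dv, gr, hg.apply_sharp' hxU, localField_apply hx]

/-- As the metric is parallel, the symmetrisation of `∇Y` differentiates to that of `∇²Y`. -/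
theorem nablaTensor_divAdjoint {Y : Π x : M, TangentSpace (𝓡 n) x}
    (hY : ContDiffOn ℝ ∞ (localField x₀ Y) U) (v u w : TangentSpace (𝓡 n) x) :
    nablaTensor (divAdjoint Y) x v u w = (-1 / 2 : ℝ) *
      (localMetric x₀ (extChartAt (𝓡 n) x₀ x) (hessian (localMetric x₀) (localField x₀ Y)
          (extChartAt (𝓡 n) x₀ x) (coordAt x₀ x v) (coordAt x₀ x u)) (coordAt x₀ x w)
        + localMetric x₀ (extChartAt (𝓡 n) x₀ x) (hessian (localMetric x₀) (localField x₀ Y)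
          (extChartAt (𝓡 n) x₀ x) (coordAt x₀ x v) (coordAt x₀ x w)) (coordAt x₀ x u)) := by
  have hg := (isMetricOn_localMetric (n := n) x₀).mono hU hUt
  have hu := differentiableAt_localField_ext hx u
  have hw := differentiableAt_localField_ext hx w
  have hN := hg.differentiableAt (hg.contDiffOn_nab hY) hxU
  have hG := hg.differentiableAt hg.smooth hxU
  have hF : (fun z => divAdjoint Y z (ext u z) (ext w z)) ∘ (extChartAt (𝓡 n) x₀).symm
      =ᶠ[nhds (extChartAt (𝓡 n) x₀ x)] fun y => (-1 / 2 : ℝ) *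
        (localMetric x₀ y (nab (localMetric x₀) (localField x₀ Y) y (localField x₀ (ext u) y))
            (localField x₀ (ext w) y)
          + localMetric x₀ y (nab (localMetric x₀) (localField x₀ Y) y (localField x₀ (ext w) y))
            (localField x₀ (ext u) y)) := by
    filter_upwards [hU.mem_nhds hxU,
      inner_comp_chart_symm hx (fun z => nabla Y z (ext u z)) (ext w),
      inner_comp_chart_symm hx (fun z => nabla Y z (ext w z)) (ext u)] with y hy h1 h2
    rw [localField_nabla hU hUt hY _ y hy] at h1 h2
    rw [← h1, ← h2]
    exact divAdjoint_apply Y _ _ _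
  have h1 : DifferentiableAt ℝ (fun y => localMetric x₀ y (nab (localMetric x₀)
      (localField x₀ Y) y (localField x₀ (ext u) y)) (localField x₀ (ext w) y))
      (extChartAt (𝓡 n) x₀ x) := by fun_prop
  have h2 : DifferentiableAt ℝ (fun y => localMetric x₀ y (nab (localMetric x₀)
      (localField x₀ Y) y (localField x₀ (ext w) y)) (localField x₀ (ext u) y))
      (extChartAt (𝓡 n) x₀ x) := by fun_prop
  have hYd := hg.differentiableAt hY hxU
  rw [nablaTensor, mvfderiv_eq_fderiv hx (((h1.add h2).const_mul _).congr_of_eventuallyEq hF),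
    hF.fderiv_eq, fderiv_const_mul (h1.fun_add h2), fderiv_fun_add h1 h2, smul_apply, add_apply,
    hg.fderiv_apply_nab hY hu hw hxU, hg.fderiv_apply_nab hY hw hu hxU,
    divAdjoint_apply, divAdjoint_apply]
  simp only [inner_eq_localMetric hx, coordAt_nabla hx hYd, coordAt_nabla hx hu,
    coordAt_nabla hx hw, localField_apply hx, ext_self, smul_eq_mul]
  ring

theorem coordAt_opP {f : M → ℝ} (hf : ContDiffOn ℝ ∞ (f ∘ (extChartAt (𝓡 n) x₀).symm) U)
    {Y : Π x : M, TangentSpace (𝓡 n) x} (hY : ContDiffOn ℝ ∞ (localField x₀ Y) U) :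
    coordAt x₀ x (opP f Y x) = op (localMetric x₀)
      (f ∘ (extChartAt (𝓡 n) x₀).symm) (localField x₀ Y) (extChartAt (𝓡 n) x₀ x) := by
  have hg := (isMetricOn_localMetric (n := n) x₀).mono hU hUt
  have hYd := hg.differentiableAt hY hxU
  have hdrift : drift (localMetric x₀) (f ∘ (extChartAt (𝓡 n) x₀).symm) (localField x₀ Y)
      (extChartAt (𝓡 n) x₀ x) = ∑ j, hessian (localMetric x₀) (localField x₀ Y)
        (extChartAt (𝓡 n) x₀ x) (coordAt x₀ x (frame x j)) (coordAt x₀ x (frame x j))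
      - nab (localMetric x₀) (localField x₀ Y) (extChartAt (𝓡 n) x₀ x)
        (gr (localMetric x₀) (f ∘ (extChartAt (𝓡 n) x₀).symm) (extChartAt (𝓡 n) x₀ x)) := by
    rw [drift, sum_frame_eq hx]
  -- Writing the target as `sharp` of its dual covector expands it in the same frame, so
  -- coefficients can be compared.
  rw [← hg.sharp_apply hxU (op _ _ _ _), sharp_eq_sum_frame hx, opP, divfTensor, map_sum]
  refine Finset.sum_congr rfl fun i _ => ?_
  have htr := sum_localMetric_frame_eq hx ((hessian (localMetric x₀) (localField x₀ Y)
    (extChartAt (𝓡 n) x₀ x)).flip (coordAt x₀ x (frame x i)))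
  rw [map_smul, op, hdrift, divTranspose, divAdjoint_apply]
  congr 1
  simp only [nablaTensor_divAdjoint hx hU hUt hxU hY, inner_eq_localMetric hx,
    coordAt_nabla hx hYd, coordAt_grad hx (hg.differentiableAt hf hxU), map_smul, map_add, map_sub,
    smul_apply, add_apply, sub_apply, smul_eq_mul, hg.apply_sharp hxU, map_sum, sum_apply,
    ContinuousLinearMap.comp_apply, ← Finset.mul_sum, Finset.sum_add_distrib]
  rw [← htr]
  simp only [gr, hg.apply_sharp' hxU, ContinuousLinearMap.flip_apply]
  ring

end Operators

end RicciSoliton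
-- Passage from charts to the manifold.
namespace RicciSoliton

open LocalMetric

section Commutation

variable {n : ℕ} {M : Type*} [TopologicalSpace M] [ChartedSpace (EuclideanSpace ℝ (Fin n)) M]
  [IsManifold (𝓡 n) ∞ M] [RiemannianBundle (fun x : M => TangentSpace (𝓡 n) x)]
  [IsContMDiffRiemannianBundle (𝓡 n) ∞ (EuclideanSpace ℝ (Fin n))
    (fun x : M => TangentSpace (𝓡 n) x)]

variable {x₀ : M}

theorem localField_grad {u : M → ℝ} (hu : ContDiffOn ℝ ∞ (u ∘ (extChartAt (𝓡 n) x₀).symm)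
    (extChartAt (𝓡 n) x₀).target) :
    ∀ y ∈ (extChartAt (𝓡 n) x₀).target, localField x₀ (grad u) y =
      gr (localMetric x₀) (u ∘ (extChartAt (𝓡 n) x₀).symm) y := by
  intro y hy
  have hx := (extChartAt (𝓡 n) x₀).map_target hy
  have h := coordAt_grad hx
    ((isMetricOn_localMetric (n := n) x₀).differentiableAt hu (chart_mem_target hx))
  rw [(extChartAt (𝓡 n) x₀).right_inv hy] at h
  exact h

variable {f : M → ℝ} (hf : ContDiffOn ℝ ∞ (f ∘ (extChartAt (𝓡 n) x₀).symm)
    (extChartAt (𝓡 n) x₀).target)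
include hf

/-- Valid on the whole chart target, so that a further operator can be applied to the result. -/
theorem localField_driftLaplacian {Y : Π x : M, TangentSpace (𝓡 n) x}
    (hY : ContDiffOn ℝ ∞ (localField x₀ Y) (extChartAt (𝓡 n) x₀).target) :
    ∀ y ∈ (extChartAt (𝓡 n) x₀).target, localField x₀ (driftLaplacian f Y) y =
      drift (localMetric x₀) (f ∘ (extChartAt (𝓡 n) x₀).symm) (localField x₀ Y) y := by
  intro y hy
  have hx := (extChartAt (𝓡 n) x₀).map_target hy
  have h := coordAt_driftLaplacian hx (isOpen_extChartAt_target x₀) subset_rfl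
    (chart_mem_target hx) hf hY
  rw [(extChartAt (𝓡 n) x₀).right_inv hy] at h
  exact h

theorem localField_opP {Y : Π x : M, TangentSpace (𝓡 n) x}
    (hY : ContDiffOn ℝ ∞ (localField x₀ Y) (extChartAt (𝓡 n) x₀).target) :
    ∀ y ∈ (extChartAt (𝓡 n) x₀).target, localField x₀ (opP f Y) y =
      op (localMetric x₀) (f ∘ (extChartAt (𝓡 n) x₀).symm) (localField x₀ Y) y := by
  intro y hy
  have hx := (extChartAt (𝓡 n) x₀).map_target hy
  have h := coordAt_opP hx (isOpen_extChartAt_target x₀) subset_rfl (chart_mem_target hx) hf hY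
  rw [(extChartAt (𝓡 n) x₀).right_inv hy] at h
  exact h

theorem divf_comp_chart_symm {Y : Π x : M, TangentSpace (𝓡 n) x}
    (hY : ContDiffOn ℝ ∞ (localField x₀ Y) (extChartAt (𝓡 n) x₀).target) :
    ∀ y ∈ (extChartAt (𝓡 n) x₀).target, (divf f Y ∘ (extChartAt (𝓡 n) x₀).symm) y =
      dv (localMetric x₀) (f ∘ (extChartAt (𝓡 n) x₀).symm) (localField x₀ Y) y := by
  intro y hy
  have hx := (extChartAt (𝓡 n) x₀).map_target hy
  have h := divf_eq hx (isOpen_extChartAt_target x₀) subset_rfl (chart_mem_target hx) hf hY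
  rw [(extChartAt (𝓡 n) x₀).right_inv hy] at h
  exact h

variable {κ : ℝ}

omit hf in
theorem IsGradientRicciSoliton.local_eq (hsol : IsGradientRicciSoliton (n := n) f κ) :
    ∀ y ∈ (extChartAt (𝓡 n) x₀).target, ∀ v w, ric (localMetric x₀) y v w
      + localMetric x₀ y (nab (localMetric x₀)
        (gr (localMetric x₀) (f ∘ (extChartAt (𝓡 n) x₀).symm)) y v) w
      = κ * localMetric x₀ y v w := by
  intro y hy v w
  have hg := isMetricOn_localMetric (n := n) x₀
  have hf := contDiffOn_comp_chart_symm (x₀ := x₀) hsol.smooth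
  have hx := (extChartAt (𝓡 n) x₀).map_target hy
  have hgrad := (hg.contDiffOn_gr hf).congr (localField_grad hf)
  have h := hsol.eq _ (coordSymm x₀ ((extChartAt (𝓡 n) x₀).symm y) v)
    (coordSymm x₀ ((extChartAt (𝓡 n) x₀).symm y) w)
  rwa [ricci_eq hx, hess, inner_eq_localMetric hx,
    coordAt_nabla hx (hg.differentiableAt hgrad (chart_mem_target hx)), inner_eq_localMetric hx,
    coordAt_coordSymm hx, coordAt_coordSymm hx, (extChartAt (𝓡 n) x₀).right_inv hy,
    hg.nab_congr (localField_grad hf) hy] at h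

omit hf in
theorem driftLaplacian_opP (hsol : IsGradientRicciSoliton (n := n) f κ)
    {V : Π x : M, TangentSpace (𝓡 n) x}
    (hV : ContMDiff (𝓡 n) (𝓡 n).tangent ∞ (fun x => (⟨x, V x⟩ : TangentBundle (𝓡 n) M))) :
    driftLaplacian f (opP f V) = opP f (driftLaplacian f V) := by
  funext x
  -- The identity is checked at each `x` in the chart centred there.
  have hx := mem_extChartAt_source (I := 𝓡 n) x
  have hxt := chart_mem_target hx
  have hg := isMetricOn_localMetric (n := n) x
  have hf := contDiffOn_comp_chart_symm (x₀ := x) hsol.smooth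
  have hY := contDiffOn_localField (x₀ := x) hV
  have hP := (hg.contDiffOn_op hf hY).congr (localField_opP hf hY)
  have hL := (hg.contDiffOn_drift hf hY).congr (localField_driftLaplacian hf hY)
  refine coordAt_injective hx ?_
  rw [← localField_apply hx, ← localField_apply hx, localField_driftLaplacian hf hP _ hxt,
    localField_opP hf hL _ hxt, hg.drift_congr (localField_opP hf hY) hxt,
    hg.op_congr (localField_driftLaplacian hf hY) hxt]
  exact hg.drift_op hf hsol.local_eq hY hxt

omit hf in
theorem opP_grad_divf (hsol : IsGradientRicciSoliton (n := n) f κ)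
    {V : Π x : M, TangentSpace (𝓡 n) x}
    (hV : ContMDiff (𝓡 n) (𝓡 n).tangent ∞ (fun x => (⟨x, V x⟩ : TangentBundle (𝓡 n) M))) :
    opP f (grad (n := n) (divf f V)) = grad (n := n) (divf f (opP f V)) := by
  funext x
  have hx := mem_extChartAt_source (I := 𝓡 n) x
  have hxt := chart_mem_target hx
  have hg := isMetricOn_localMetric (n := n) x
  have hf := contDiffOn_comp_chart_symm (x₀ := x) hsol.smooth
  have hY := contDiffOn_localField (x₀ := x) hV
  have hP := (hg.contDiffOn_op hf hY).congr (localField_opP hf hY)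
  have hdV := (hg.contDiffOn_dv hf hY).congr (divf_comp_chart_symm hf hY)
  have hdP := (hg.contDiffOn_dv hf hP).congr (divf_comp_chart_symm hf hP)
  have hG := (hg.contDiffOn_gr hdV).congr (localField_grad hdV)
  refine coordAt_injective hx ?_
  rw [← localField_apply hx, ← localField_apply hx, localField_opP hf hG _ hxt,
    localField_grad hdP _ hxt, hg.op_congr (localField_grad hdV) hxt,
    hg.op_congr (fun y hy => hg.gr_congr (divf_comp_chart_symm hf hY) hy) hxt,
    hg.gr_congr (divf_comp_chart_symm hf hP) hxt,
    hg.gr_congr (fun y hy => hg.dv_congr (localField_opP hf hY) hy) hxt]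
  exact hg.op_gr_dv hf hsol.local_eq hY hxt

end Commutation

end RicciSoliton
end

theorem proposition3 {n : ℕ} {M : Type*} [TopologicalSpace M] [T2Space M]
    [SecondCountableTopology M] [ChartedSpace (EuclideanSpace ℝ (Fin n)) M]
    [IsManifold (𝓡 n) ∞ M] [RiemannianBundle (fun x : M => TangentSpace (𝓡 n) x)]
    [IsContMDiffRiemannianBundle (𝓡 n) ∞ (EuclideanSpace ℝ (Fin n))
      (fun x : M => TangentSpace (𝓡 n) x)]
    (f : M → ℝ) (κ : ℝ) (hsol : RicciSoliton.IsGradientRicciSoliton (n := n) f κ)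
    (V : Π x : M, TangentSpace (𝓡 n) x)
    (hV : ContMDiff (𝓡 n) (𝓡 n).tangent ∞ (fun x => (⟨x, V x⟩ : TangentBundle (𝓡 n) M))) :
    RicciSoliton.driftLaplacian f (RicciSoliton.opP f V)
        = RicciSoliton.opP f (RicciSoliton.driftLaplacian f V) ∧
      RicciSoliton.opP f (RicciSoliton.grad (n := n) (RicciSoliton.divf f V))
        = RicciSoliton.grad (n := n) (RicciSoliton.divf f (RicciSoliton.opP f V)) :=
  ⟨RicciSoliton.driftLaplacian_opP hsol hV, RicciSoliton.opP_grad_divf hsol hV⟩
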